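/- **Theorem.** Let $D^2=\{x\in\mathbb R^2:|x|<1\}$, let $\nu$ be the outward unit normal and $\tau$ the counterclockwise unit tangent on $\partial D^2$, and write $\nabla^\perp b=(\partial_{2}b,-\partial_{1}b)$, so that $\nabla a\cdot\nabla^\perp b=\partial_{1}a\,\partial_{2}b-\partial_{2}a\,\partial_{1}b$. There exist $a,b\in L^\infty(D^2)\cap H^1(D^2)$ such that the Neumann problem $$-\Delta\varphi=\nabla a\cdot\nabla^\perp b\ \text{ in } D^2,\qquad \partial_\nu\varphi=-a\,\partial_\tau b\ \text{ on }\partial D^2$$ has a solution $\varphi\in W^{1,1}(D^2)$ with $\int_{D^2}\varphi=0$, this solution is unique (up to a null set) in that class, and it is not in $L^\infty(\overline{D^2})$. Solutions are understood in the weak sense: for every $\zeta\in C^\infty(\overline{D^2})$, $$\int_{D^2}\nabla\varphi\cdot\nabla\zeta\,dx=\int_{D^2}(\nabla a\cdot\nabla^\perp b)\,\zeta\,dx-\langle\partial_\tau b,\,a\zeta\rangle_{\partial D^2},$$ where, for $b,g\in H^1(D^2)$, $\langle\partial_\tau b,g\rangle_{\partial D^2}=\int_{D^2}\nabla^\perp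 b\cdot\nabla g\,dx$ is the $H^{-1/2}$–$H^{1/2}$ duality on $\partial D^2$ (the generalised normal trace of the divergence-free field $\nabla^\perp b$), which equals $\int_{\partial D^2}g\,\partial_\tau b\,d\sigma$ for smooth $b,g$. -/

import Mathlib

open MeasureTheory Set
open scoped ContDiff ENNReal

noncomputable section

namespace NeumannJacobian

/-- The open unit disc `D²` of the Euclidean plane `ℝ² = ℂ` (`x₁ = re`, `x₂ = im`). -/
def disc : Set ℂ := Metric.ball 0 1

/-- The vector field `G` is the gradient of `u` on the disc in the sense of distributions:
`∫ u ∇η = - ∫ η G` for every test function `η ∈ C_c^∞(D²)`. -/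
structure IsWeakGradient (u : ℂ → ℝ) (G : ℂ → ℂ) : Prop where
  locallyIntegrable : LocallyIntegrableOn u disc
  locallyIntegrable_grad : LocallyIntegrableOn G disc
  integral_eq : ∀ η : ℂ → ℝ, ContDiff ℝ ∞ η → HasCompactSupport η → tsupport η ⊆ disc →
    ∫ z in disc, u z • gradient η z = - ∫ z in disc, η z • G z

open Classical in
/-- The weak gradient `∇u` on the disc; it is determined up to a null set. -/
def weakGrad (u : ℂ → ℝ) : ℂ → ℂ :=
  if h : ∃ G, IsWeakGradient u G then h.choose else 0

/-- The Sobolev space `W^{1,p}(D²)`; `p = 2` is `H¹(D²)`. -/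
def MemW1 (p : ℝ≥0∞) (u : ℂ → ℝ) : Prop :=
  MemLp u p (volume.restrict disc) ∧
    ∃ G, IsWeakGradient u G ∧ MemLp G p (volume.restrict disc)

/-- The rotation `(v₁, v₂) ↦ (v₂, -v₁)`, so that `perp (∇b) = ∇^⊥ b = (∂₂b, -∂₁b)`. -/
def perp (v : ℂ) : ℂ := ⟨v.im, -v.re⟩

/-- The Jacobian `∇a · ∇^⊥ b = ∂₁a ∂₂b - ∂₂a ∂₁b`. -/
def jacobian (a b : ℂ → ℝ) (z : ℂ) : ℝ := inner ℝ (weakGrad a z) (perp (weakGrad b z))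

/-- The duality `⟨∂_τ b, g⟩` between `∂_τ b ∈ H^{-1/2}(∂D²)` and the trace of `g` in
`H^{1/2}(∂D²)`, for `b, g ∈ H¹(D²)`. Since `∂_τ b = ν · ∇^⊥ b` for the counterclockwise tangent `τ`
and the outward normal `ν`, and since `∇^⊥ b` is square integrable and divergence free, this is the
generalised normal trace of `∇^⊥ b`, namely `∫ ∇^⊥ b · ∇g`. For smooth `b`, `g` it is the integral
of `g ∂_τ b` over the circle: see `tangentialPairing_of_contDiff`. -/
def tangentialPairing (b g : ℂ → ℝ) : ℝ :=
  ∫ z in disc, inner ℝ (perp (weakGrad b z)) (weakGrad g z)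

/-- `φ ∈ W^{1,1}(D²)` solves `-Δφ = ∇a · ∇^⊥ b` in `D²` and `∂_ν φ = - a ∂_τ b` on `∂D²`, weakly:
`∫ ∇φ · ∇ζ = ∫ (∇a · ∇^⊥ b) ζ + ⟨∂_ν φ, ζ⟩` for every `ζ ∈ C^∞` up to the boundary, where
`⟨∂_ν φ, ζ⟩ = - ⟨a ∂_τ b, ζ⟩ = - ⟨∂_τ b, a ζ⟩`. -/
structure IsNeumannSolution (a b φ : ℂ → ℝ) : Prop where
  memW1 : MemW1 1 φ
  weak_eq : ∀ ζ : ℂ → ℝ, ContDiff ℝ ∞ ζ →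
    ∫ z in disc, inner ℝ (weakGrad φ z) (gradient ζ z) =
      (∫ z in disc, jacobian a b z * ζ z) - tangentialPairing b (fun z => a z * ζ z)

/-- A solution with zero mean value. -/
structure IsZeroMeanNeumannSolution (a b φ : ℂ → ℝ) : Prop extends IsNeumannSolution a b φ where
  zero_mean : ∫ z in disc, φ z = 0

theorem IsWeakGradient.ae_eq {u : ℂ → ℝ} {G G' : ℂ → ℂ} (h : IsWeakGradient u G)
    (h' : IsWeakGradient u G') : G =ᵐ[volume.restrict disc] G' := by
  have key := Metric.isOpen_ball.ae_eq_zero_of_integral_contDiff_smul_eq_zero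
    (U := disc) (μ := volume) (f := fun z => G z - G' z)
    (h.locallyIntegrable_grad.sub h'.locallyIntegrable_grad) (by
      intro η hη hc hs
      have int : ∀ F : ℂ → ℂ, LocallyIntegrableOn F disc →
          IntegrableOn (fun z => η z • F z) disc := by
        intro F hF
        have h0 : IntegrableOn F (tsupport η) := hF.integrableOn_compact_subset hs hc.isCompact
        have h1 : IntegrableOn (fun z => η z • F z) (tsupport η) :=
          h0.continuousOn_smul hη.continuous.continuousOn hc.isCompact
        refine h1.of_forall_sdiff_eq_zero Metric.isOpen_ball.measurableSet ?_
        intro z hz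
        simp [image_eq_zero_of_notMem_tsupport hz.2]
      have e1 := h.integral_eq η hη hc hs
      have e2 := h'.integral_eq η hη hc hs
      have e3 : ∫ z in disc, η z • G z = ∫ z in disc, η z • G' z :=
        neg_injective (e1.symm.trans e2)
      rw [← setIntegral_eq_integral_of_forall_compl_eq_zero (s := disc)]
      · simp only [smul_sub]
        rw [integral_sub (int G h.locallyIntegrable_grad) (int G' h'.locallyIntegrable_grad), e3,
          sub_self]
      · intro z hz
        simp [image_eq_zero_of_notMem_tsupport (fun hh => hz (hs hh))])
  rw [Filter.EventuallyEq, ae_restrict_iff' (s := disc) Metric.isOpen_ball.measurableSet]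
  filter_upwards [key] with z hz hd
  exact sub_eq_zero.1 (hz hd)

theorem weakGrad_spec {u : ℂ → ℝ} {G : ℂ → ℂ} (h : IsWeakGradient u G) :
    IsWeakGradient u (weakGrad u) := by
  have h0 : ∃ G, IsWeakGradient u G := ⟨G, h⟩
  rw [weakGrad, dif_pos h0]
  exact h0.choose_spec

theorem weakGrad_ae_eq {u : ℂ → ℝ} {G : ℂ → ℂ} (h : IsWeakGradient u G) :
    weakGrad u =ᵐ[volume.restrict disc] G :=
  (weakGrad_spec h).ae_eq h

theorem gradient_eq_mk (u : ℂ → ℝ) (z : ℂ) :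
    gradient u z = ⟨fderiv ℝ u z 1, fderiv ℝ u z Complex.I⟩ := by
  have h1 : inner ℝ (gradient u z) (1 : ℂ) = fderiv ℝ u z 1 := inner_gradient_left
  have h2 : inner ℝ (gradient u z) Complex.I = fderiv ℝ u z Complex.I := inner_gradient_left
  apply Complex.ext
  · rw [← h1, Complex.inner]; simp
  · rw [← h2, Complex.inner]; simp

theorem continuous_gradient {u : ℂ → ℝ} (hu : ContDiff ℝ ∞ u) : Continuous (gradient u) := by
  have := hu.continuous_fderiv (by simp)
  exact (InnerProductSpace.toDual ℝ ℂ).symm.continuous.comp this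

theorem isWeakGradient_gradient {u : ℂ → ℝ} (hu : ContDiff ℝ ∞ u) :
    IsWeakGradient u (gradient u) := by
  refine ⟨hu.continuous.locallyIntegrable.locallyIntegrableOn _,
    (continuous_gradient hu).locallyIntegrable.locallyIntegrableOn _, ?_⟩
  intro η hη hc hs
  have hz : ∀ z, z ∉ disc → gradient η z = 0 := by
    intro z hz
    have : fderiv ℝ η z = 0 :=
      image_eq_zero_of_notMem_tsupport (fun hh => hz (hs (tsupport_fderiv_subset ℝ hh)))
    simp [gradient, this]
  rw [setIntegral_eq_integral_of_forall_compl_eq_zero (fun z h => by simp [hz z h]),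
    setIntegral_eq_integral_of_forall_compl_eq_zero (fun z h => by
      simp [image_eq_zero_of_notMem_tsupport (fun hh => h (hs hh))])]
  have cη := hη.continuous_fderiv (by simp)
  have cu := hu.continuous_fderiv (by simp)
  have hcf : HasCompactSupport (fderiv ℝ η) := hc.fderiv ℝ
  have hcg : HasCompactSupport (gradient η) := by
    refine hcf.comp_left (g := (InnerProductSpace.toDual ℝ ℂ).symm) (by simp)
  have i1 : Integrable (fun z => u z • gradient η z) :=
    (hu.continuous.smul (continuous_gradient hη)).integrable_of_hasCompactSupport hcg.smul_left
  have i2 : Integrable (fun z => η z • gradient u z) :=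
    (hη.continuous.smul (continuous_gradient hu)).integrable_of_hasCompactSupport hc.smul_right
  have parts : ∀ v : ℂ, ∫ z, u z * fderiv ℝ η z v = - ∫ z, fderiv ℝ u z v * η z := by
    intro v
    apply integral_mul_fderiv_eq_neg_fderiv_mul_of_integrable
    · exact ((cu.clm_apply continuous_const).mul hη.continuous).integrable_of_hasCompactSupport
        hc.mul_left
    · refine (hu.continuous.mul (cη.clm_apply continuous_const)).integrable_of_hasCompactSupport
        (HasCompactSupport.mul_left ?_)
      exact hcf.comp_left (g := fun L : ℂ →L[ℝ] ℝ => L v) (by simp)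
    · exact (hu.continuous.mul hη.continuous).integrable_of_hasCompactSupport hc.mul_left
    · exact fun z _ => hu.differentiable (by simp) z
    · exact fun z _ => hη.differentiable (by simp) z
  apply ext_inner_right ℝ
  intro v
  rw [inner_neg_left, real_inner_comm v, real_inner_comm v, ← integral_inner i1, ← integral_inner i2]
  simp only [inner_smul_right, inner_gradient_right, conj_trivial]
  rw [parts v]
  simp only [mul_comm]

theorem setIntegral_disc_polar {F : ℂ → ℝ} (cF : Continuous F) :
    ∫ z in disc, F z =
      ∫ r in (0 : ℝ)..1, ∫ t in (-Real.pi)..Real.pi, r * F (r * circleMap 0 1 t) := by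
  have hsym : ∀ p : ℝ × ℝ, Complex.polarCoord.symm p = p.1 * circleMap 0 1 p.2 := by
    intro p
    simp only [Complex.polarCoord_symm_apply, circleMap, Complex.exp_mul_I]
    simp
  have hm : MeasurableSet disc := Metric.isOpen_ball.measurableSet
  rw [← integral_indicator hm, ← Complex.integral_comp_polarCoord_symm]
  have hset : ∫ p in polarCoord.target, p.1 • disc.indicator F (Complex.polarCoord.symm p) =
      ∫ p in Ioo (0 : ℝ) 1 ×ˢ Ioo (-Real.pi) Real.pi, p.1 * F (p.1 * circleMap 0 1 p.2) := by
    simp only [hsym]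
    rw [polarCoord_target]
    rw [← integral_indicator (measurableSet_Ioi.prod measurableSet_Ioo),
      ← integral_indicator (measurableSet_Ioo.prod measurableSet_Ioo)]
    congr 1
    ext p
    have hd : 0 < p.1 → ((p.1 * circleMap 0 1 p.2 : ℂ) ∈ disc ↔ p.1 < 1) := by
      intro hp
      simp [disc, circleMap, Complex.norm_exp_ofReal_mul_I, abs_of_pos hp]
    simp only [indicator, mem_prod, mem_Ioi, mem_Ioo, smul_eq_mul]
    by_cases hp : 0 < p.1
    · by_cases hp1 : p.1 < 1 <;> simp [hd hp, hp, hp1]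
    · simp [hp]
  rw [hset, Measure.volume_eq_prod, setIntegral_prod]
  · rw [intervalIntegral.integral_of_le zero_le_one, integral_Ioc_eq_integral_Ioo]
    refine setIntegral_congr_fun measurableSet_Ioo fun r _ => ?_
    simp only
    rw [intervalIntegral.integral_of_le (by linarith [Real.pi_pos]),
      integral_Ioc_eq_integral_Ioo]
  · have cc : Continuous fun p : ℝ × ℝ => p.1 * F (p.1 * circleMap 0 1 p.2) := by
      have := continuous_circleMap 0 1
      fun_prop
    exact (cc.continuousOn.integrableOn_compact
      (isCompact_Icc.prod isCompact_Icc)).mono_set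
        (prod_mono Ioo_subset_Icc_self Ioo_subset_Icc_self)

/-- Consistency of `tangentialPairing` with the classical boundary integral of `g ∂_τ b`. -/
theorem tangentialPairing_of_contDiff {b g : ℂ → ℝ} (hb : ContDiff ℝ ∞ b) (hg : ContDiff ℝ ∞ g) :
    tangentialPairing b g =
      ∫ θ in (-Real.pi)..Real.pi,
        g (circleMap 0 1 θ) * deriv (fun t => b (circleMap 0 1 t)) θ := by
  set e : ℝ → ℂ := fun t => circleMap 0 1 t with he
  have hde : ∀ t, HasDerivAt e (e t * Complex.I) t := fun t => by
    simpa [he] using hasDerivAt_circleMap 0 1 t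
  have ce : ContDiff ℝ ∞ e := contDiff_circleMap 0 1
  have cβ : ContDiff ℝ ∞ (fderiv ℝ b) := hb.fderiv_right (by simp)
  set F : ℂ → ℝ := fun z => inner ℝ (perp (gradient b z)) (gradient g z) with hF
  have hFe : ∀ z t, fderiv ℝ g z (e t) * fderiv ℝ b z (e t * Complex.I) -
      fderiv ℝ g z (e t * Complex.I) * fderiv ℝ b z (e t) = F z := by
    intro z t
    have h1 : e t = Real.cos t • (1 : ℂ) + Real.sin t • Complex.I := by
      simp [he, circleMap, Complex.exp_mul_I]
    have h2 : e t * Complex.I = (-Real.sin t) • (1 : ℂ) + Real.cos t • Complex.I := by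
      rw [h1]; apply Complex.ext <;> simp
    rw [h2, h1]
    simp only [map_add, map_smul, smul_eq_mul, hF, gradient_eq_mk, perp, Complex.inner]
    simp only [Complex.mul_re, Complex.conj_re, Complex.conj_im]
    linear_combination (fderiv ℝ g z 1 * fderiv ℝ b z Complex.I -
      fderiv ℝ g z Complex.I * fderiv ℝ b z 1) * Real.sin_sq_add_cos_sq t
  have cF : Continuous F := by
    have : F = fun z => fderiv ℝ g z (e 0) * fderiv ℝ b z (e 0 * Complex.I) -
      fderiv ℝ g z (e 0 * Complex.I) * fderiv ℝ b z (e 0) := funext fun z => (hFe z 0).symm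
    rw [this]
    have c1 := hg.continuous_fderiv (by simp)
    have c2 := cβ.continuous
    fun_prop
  have s1 : tangentialPairing b g = ∫ z in disc, F z := by
    apply integral_congr_ae
    filter_upwards [weakGrad_ae_eq (isWeakGradient_gradient hb),
      weakGrad_ae_eq (isWeakGradient_gradient hg)] with z h1 h2
    simp only [h1, h2, hF]
  have s2 : ∫ z in disc, F z =
      ∫ r in (0 : ℝ)..1, ∫ t in (-Real.pi)..Real.pi, r * F (r * e t) :=
    setIntegral_disc_polar cF
  set p : ℝ × ℝ → ℝ := fun x =>
    g (x.1 * e x.2) * fderiv ℝ b (x.1 * e x.2) (x.1 * (e x.2 * Complex.I)) with hp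
  set q : ℝ × ℝ → ℝ := fun x => -(g (x.1 * e x.2) * fderiv ℝ b (x.1 * e x.2) (e x.2)) with hq
  have cof : ContDiff ℝ ∞ (fun x : ℝ × ℝ => (x.1 : ℂ)) :=
    Complex.ofRealCLM.contDiff.comp contDiff_fst
  have ce2 : ContDiff ℝ ∞ (fun x : ℝ × ℝ => e x.2) := ce.comp contDiff_snd
  have cP : ContDiff ℝ ∞ (fun x : ℝ × ℝ => (x.1 * e x.2 : ℂ)) := cof.mul ce2
  have cp : ContDiff ℝ ∞ p :=
    (hg.comp cP).mul ((cβ.comp cP).clm_apply (cof.mul (ce2.mul contDiff_const)))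
  have cq : ContDiff ℝ ∞ q := ((hg.comp cP).mul ((cβ.comp cP).clm_apply ce2)).neg
  have hdiv : ∀ r t : ℝ, fderiv ℝ p (r, t) (1, 0) + fderiv ℝ q (r, t) (0, 1) =
      r * F (r * e t) := by
    intro r t
    have hr : HasDerivAt (fun s : ℝ => ((s, t) : ℝ × ℝ)) (1, 0) r :=
      (hasDerivAt_id r).prodMk (hasDerivAt_const r t)
    have ht : HasDerivAt (fun s : ℝ => ((r, s) : ℝ × ℝ)) (0, 1) t :=
      (hasDerivAt_const t r).prodMk (hasDerivAt_id t)
    have dp := ((cp.differentiable (by simp) (r, t)).hasFDerivAt).comp_hasDerivAt r hr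
    have dq := ((cq.differentiable (by simp) (r, t)).hasFDerivAt).comp_hasDerivAt t ht
    have k0 : HasDerivAt (fun s : ℝ => (s : ℂ)) 1 r := Complex.ofRealCLM.hasDerivAt
    have kr : HasDerivAt (fun s : ℝ => (s * e t : ℂ)) (e t) r := by
      simpa using k0.mul_const (e t)
    have kt : HasDerivAt (fun s : ℝ => (r * e s : ℂ)) (r * (e t * Complex.I)) t :=
      (hde t).const_mul (r : ℂ)
    have krn : HasDerivAt (fun s : ℝ => (s * (e t * Complex.I) : ℂ)) (e t * Complex.I) r := by
      simpa using k0.mul_const (e t * Complex.I)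
    have dg := (hg.differentiable (by simp) (r * e t)).hasFDerivAt
    have dβ := (cβ.differentiable (by simp) (r * e t)).hasFDerivAt
    have g1 : HasDerivAt (fun s : ℝ => g (s * e t)) (fderiv ℝ g (r * e t) (e t)) r :=
      dg.comp_hasDerivAt r kr
    have g2 : HasDerivAt (fun s : ℝ => g (r * e s))
        (fderiv ℝ g (r * e t) (r * (e t * Complex.I))) t := dg.comp_hasDerivAt t kt
    have b1 : HasDerivAt (fun s : ℝ => fderiv ℝ b (s * e t))
        (fderiv ℝ (fderiv ℝ b) (r * e t) (e t)) r := dβ.comp_hasDerivAt r kr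
    have b2 : HasDerivAt (fun s : ℝ => fderiv ℝ b (r * e s))
        (fderiv ℝ (fderiv ℝ b) (r * e t) (r * (e t * Complex.I))) t := dβ.comp_hasDerivAt t kt
    have dp' := g1.mul (b1.clm_apply krn)
    have dq' := (g2.mul (b2.clm_apply (hde t))).neg
    have ep := dp.unique dp'
    have eq := dq.unique dq'
    have sym : IsSymmSndFDerivAt ℝ b (r * e t) :=
      hb.contDiffAt.isSymmSndFDerivAt (by simp; exact WithTop.coe_le_coe.2 le_top)
    have sym' := sym (e t) (r * (e t * Complex.I))
    have rs : ∀ w : ℂ, (r * w : ℂ) = r • w := fun w => by simp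
    rw [ep, eq, ← hFe _ t]
    rw [sym']
    simp only [rs, map_smul, smul_eq_mul]
    ring
  have green := integral2_divergence_prod_of_hasFDerivAt p q (fderiv ℝ p) (fderiv ℝ q)
    0 (-Real.pi) 1 Real.pi cp.continuous.continuousOn cq.continuous.continuousOn
    (fun x _ => (cp.differentiable (by simp) x).hasFDerivAt)
    (fun x _ => (cq.differentiable (by simp) x).hasFDerivAt) (by
      have c1 := cp.continuous_fderiv (by simp)
      have c2 := cq.continuous_fderiv (by simp)
      refine ContinuousOn.integrableOn_compact (isCompact_uIcc.prod isCompact_uIcc) ?_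
      exact ((c1.clm_apply continuous_const).add (c2.clm_apply continuous_const)).continuousOn)
  simp only [hdiv] at green
  rw [s1, s2, green]
  have hper : e Real.pi = e (-Real.pi) := by
    simp [he, circleMap, Complex.exp_neg]
  have e1 : ∀ x : ℝ, q (x, Real.pi) = q (x, -Real.pi) := fun x => by simp only [hq, hper]
  have e2 : ∀ y : ℝ, p (0, y) = 0 := fun y => by simp [hp]
  simp only [e1, e2, sub_self, zero_add, intervalIntegral.integral_zero, sub_zero]
  congr 1
  ext t
  have d1 := ((hb.differentiable (by simp) (e t)).hasFDerivAt).comp_hasDerivAt t (hde t)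
  have d2 : deriv (fun t => b (e t)) t = fderiv ℝ b (e t) (e t * Complex.I) := d1.deriv
  simp only [hp, Complex.ofReal_one, one_mul]
  exact congrArg (g (e t) * ·) d2.symm

end NeumannJacobian

end

/-!
Since `∇(aζ) = ζ ∇a + a ∇ζ`, the terms containing the Jacobian cancel in the weak equation, which
becomes `∫ (∇φ + a ∇^⊥ b) · ∇ζ = 0` for all smooth `ζ`.

*Existence.* It is enough to have `∇φ = - a ∇^⊥ b` pointwise (`isNeumannSolution_of_gradient_eq`).
If `F = v - i b` is holomorphic, the Cauchy–Riemann equations say `∇^⊥ b = - ∇v`; so for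
`a = 1 + cos v` the function `φ = v + sin v` is a solution, and it is unbounded as soon as `v` is.
Here `F = log (2 - log (1 - z))`: its imaginary part is an argument, hence bounded; its real part
`log |2 - log (1 - z)|` is unbounded near `z = 1`; and `|F'| ≤ 1 / (r (2 - log r))` with
`r = |1 - z|`, whose square is integrable because `1 / (r (2 - log r)²)` is the derivative of
`1 / (2 - log r)` (`memLp_deriv_logLog`). The Jacobian of `a` and `b` is `sin v |F'|²`, which does
not vanish identically.

*Uniqueness.* The difference `u` of two solutions is in `W^{1,1}`, has mean zero and satisfies
`∫ ∇u · ∇ζ = 0` for all smooth `ζ`. Integrating by parts against fields tangential to the circle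
(`IsWeakGradient.integral_tangential`) gives `∫ u Δζ = 0` whenever `∂_ν ζ = 0` on the circle. On
the disc, every monomial `Re (c z^j z̄^k)` is, up to a constant, the Laplacian of an explicit
polynomial with vanishing normal derivative (`integral_mul_reMonomial_eq_zero`), so `u` is
orthogonal to all polynomials, and it vanishes by the Stone–Weierstrass theorem.
-/

noncomputable section

namespace NeumannJacobian

/-! ### Integration by parts up to the boundary -/

theorem measurableSet_disc : MeasurableSet disc := Metric.isOpen_ball.measurableSet

theorem mem_disc_iff {z : ℂ} : z ∈ disc ↔ ‖z‖ < 1 := by simp [disc]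

instance isFiniteMeasure_restrict_disc : IsFiniteMeasure (volume.restrict disc) :=
  ⟨by simp [disc]⟩

/-- On the disc, the product of an integrable function with a function continuous on `ℂ` is
integrable. -/
theorem integrable_disc_mul {u f : ℂ → ℝ} (hu : IntegrableOn u disc) (hf : Continuous f) :
    IntegrableOn (fun z => u z * f z) disc := by
  obtain ⟨C, hC⟩ := (isCompact_closedBall (0 : ℂ) 1).exists_bound_of_continuousOn hf.continuousOn
  refine hu.mul_bdd (c := C) hf.aestronglyMeasurable ?_
  filter_upwards [ae_restrict_mem measurableSet_disc] with z hz
  exact hC z (Metric.ball_subset_closedBall hz)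

/-- A cutoff function, equal to `1` where `2 ≤ n (1 - ‖z‖²)` and to `0` where
`n (1 - ‖z‖²) ≤ 1`. -/
def discCutoff (n : ℕ) (z : ℂ) : ℝ := Real.smoothTransition (n * (1 - ‖z‖ ^ 2) - 1)

theorem contDiff_discCutoff (n : ℕ) : ContDiff ℝ ∞ (discCutoff n) := by
  have h : ContDiff ℝ ∞ (Real.smoothTransition) := Real.smoothTransition.contDiff (n := ⊤)
  have h2 : ContDiff ℝ ∞ (fun z : ℂ => ‖z‖ ^ 2) := contDiff_norm_sq ℝ
  exact h.comp ((contDiff_const.mul (contDiff_const.sub h2)).sub contDiff_const)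

theorem tsupport_discCutoff_subset {n : ℕ} (hn : 0 < n) :
    tsupport (discCutoff n) ⊆ Metric.closedBall 0 (Real.sqrt (1 - 1 / n)) := by
  refine closure_minimal ?_ Metric.isClosed_closedBall
  intro z hz
  have h0 : (0 : ℝ) < n := by exact_mod_cast hn
  have h1 : 1 < n * (1 - ‖z‖ ^ 2) := by
    by_contra! h
    exact hz (Real.smoothTransition.zero_of_nonpos (by linarith))
  have h2 : 1 / n < 1 - ‖z‖ ^ 2 := by
    rw [div_lt_iff₀ h0]; linarith
  rw [mem_closedBall_zero_iff]
  exact Real.le_sqrt_of_sq_le (by linarith)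

theorem tsupport_discCutoff_subset_disc {n : ℕ} (hn : 0 < n) :
    tsupport (discCutoff n) ⊆ disc := by
  refine (tsupport_discCutoff_subset hn).trans (Metric.closedBall_subset_ball ?_)
  rw [Real.sqrt_lt' one_pos]
  have : (0 : ℝ) < 1 / n := by positivity
  linarith

theorem hasCompactSupport_discCutoff {n : ℕ} (hn : 0 < n) : HasCompactSupport (discCutoff n) :=
  (isCompact_closedBall (0 : ℂ) (Real.sqrt (1 - 1 / n))).of_isClosed_subset
    (isClosed_tsupport _) (tsupport_discCutoff_subset hn)

theorem fderiv_discCutoff (n : ℕ) (z v : ℂ) :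
    fderiv ℝ (discCutoff n) z v =
      -2 * n * deriv Real.smoothTransition (n * (1 - ‖z‖ ^ 2) - 1) * inner ℝ z v := by
  have h : HasDerivAt Real.smoothTransition
      (deriv Real.smoothTransition (n * (1 - ‖z‖ ^ 2) - 1)) (n * (1 - ‖z‖ ^ 2) - 1) :=
    ((Real.smoothTransition.contDiff (n := 1)).differentiable (by simp) _).hasDerivAt
  have h2 : HasFDerivAt (fun z : ℂ => ‖z‖ ^ 2) (2 • (innerSL ℝ z)) z :=
    (hasStrictFDerivAt_norm_sq z).hasFDerivAt
  have h3 := h.comp_hasFDerivAt z (((h2.const_sub 1).const_mul (n : ℝ)).sub_const 1)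
  have h4 : HasFDerivAt (discCutoff n) _ z := h3
  rw [h4.fderiv]
  simp
  ring

/-- `S'` vanishes outside `[0, 1]` for the smooth transition function `S`. -/
theorem deriv_smoothTransition_eq_zero {x : ℝ} (hx : x < 0 ∨ 1 < x) :
    deriv Real.smoothTransition x = 0 := by
  rcases hx with hx | hx
  · have : Real.smoothTransition =ᶠ[nhds x] fun _ => 0 := by
      filter_upwards [gt_mem_nhds hx] with y hy
      exact Real.smoothTransition.zero_of_nonpos hy.le
    rw [this.deriv_eq]; simp
  · have : Real.smoothTransition =ᶠ[nhds x] fun _ => 1 := by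
      filter_upwards [lt_mem_nhds hx] with y hy
      exact Real.smoothTransition.one_of_one_le hy.le
    rw [this.deriv_eq]; simp

theorem exists_bound_deriv_smoothTransition :
    ∃ M, 0 ≤ M ∧ ∀ x, |deriv Real.smoothTransition x| ≤ M := by
  have hc : Continuous (deriv Real.smoothTransition) :=
    (Real.smoothTransition.contDiff (n := 1)).continuous_deriv (by simp)
  obtain ⟨M, hM⟩ := (isCompact_Icc (a := (0 : ℝ)) (b := 1)).exists_bound_of_continuousOn
    hc.continuousOn
  refine ⟨M, (norm_nonneg _).trans (hM 0 (by simp)), fun x => ?_⟩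
  by_cases hx : x ∈ Icc (0 : ℝ) 1
  · exact hM x hx
  · rw [mem_Icc, not_and_or, not_le, not_le] at hx
    rw [deriv_smoothTransition_eq_zero hx, abs_zero]
    exact (norm_nonneg _).trans (hM 0 (by simp))

theorem eventually_two_lt_mul_one_sub_sq {z : ℂ} (hz : z ∈ disc) :
    ∀ᶠ n : ℕ in Filter.atTop, 2 < n * (1 - ‖z‖ ^ 2) := by
  have h0 : 0 < 1 - ‖z‖ ^ 2 := by
    have := mem_disc_iff.1 hz
    nlinarith [norm_nonneg z]
  have := (tendsto_natCast_atTop_atTop (R := ℝ)).atTop_mul_const h0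
  exact this.eventually_gt_atTop 2

/-- The weak gradient may be tested, one component at a time, against a smooth function times a
cutoff. -/
theorem IsWeakGradient.integral_cutoff {u : ℂ → ℝ} {G : ℂ → ℂ} (h : IsWeakGradient u G)
    (hu : IntegrableOn u disc) (hG : IntegrableOn G disc) {p : ℂ → ℝ} (hp : ContDiff ℝ ∞ p)
    {n : ℕ} (hn : 0 < n) (v : ℂ) :
    ∫ z in disc, u z * (discCutoff n z * fderiv ℝ p z v + p z * fderiv ℝ (discCutoff n) z v) =
      - ∫ z in disc, discCutoff n z * p z * inner ℝ (G z) v := by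
  set η : ℂ → ℝ := fun z => discCutoff n z * p z with hη
  have cη : ContDiff ℝ ∞ η := (contDiff_discCutoff n).mul hp
  have sη : HasCompactSupport η := (hasCompactSupport_discCutoff hn).mul_right
  have tη : tsupport η ⊆ disc :=
    (tsupport_mul_subset_left).trans (tsupport_discCutoff_subset_disc hn)
  have key := congrArg (fun w => inner ℝ v w) (h.integral_eq η cη sη tη)
  have i1 : IntegrableOn (fun z => u z • gradient η z) disc := by
    obtain ⟨C, hC⟩ := (continuous_gradient cη).bounded_above_of_compact_support
      ((sη.fderiv ℝ).comp_left (g := (InnerProductSpace.toDual ℝ ℂ).symm) (by simp))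
    exact hu.smul_bdd C (continuous_gradient cη).aestronglyMeasurable
      (Filter.Eventually.of_forall hC)
  have i2 : IntegrableOn (fun z => η z • G z) disc := by
    obtain ⟨C, hC⟩ := cη.continuous.bounded_above_of_compact_support sη
    exact hG.bdd_smul C cη.continuous.aestronglyMeasurable (Filter.Eventually.of_forall hC)
  simp only [inner_neg_right] at key
  rw [← integral_inner i1, ← integral_inner i2] at key
  simp only [inner_smul_right, inner_gradient_right, conj_trivial, hη] at key
  rw [show (∫ z in disc, discCutoff n z * p z * inner ℝ (G z) v) =
    ∫ z in disc, discCutoff n z * p z * inner ℝ v (G z) by simp only [real_inner_comm], ← key]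
  congr 1
  ext z
  rw [fderiv_fun_mul ((contDiff_discCutoff n).differentiable (by simp) z)
    (hp.differentiable (by simp) z)]
  simp

/-- Integration by parts up to the boundary, against a smooth field `(p, q)` that is tangential on
the unit circle: its radial component is `O(1 - ‖z‖²)`. The radial derivative of the cutoff is of
order `(1 - ‖z‖²)⁻¹` on its support, so the error terms are dominated and tend to zero. -/
theorem IsWeakGradient.integral_tangential {u : ℂ → ℝ} {G : ℂ → ℂ} (h : IsWeakGradient u G)
    (hu : IntegrableOn u disc) (hG : IntegrableOn G disc) {p q : ℂ → ℝ} (hp : ContDiff ℝ ∞ p)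
    (hq : ContDiff ℝ ∞ q) {C : ℝ}
    (hC : ∀ z ∈ disc, |z.re * p z + z.im * q z| ≤ C * (1 - ‖z‖ ^ 2)) :
    ∫ z in disc, u z * (fderiv ℝ p z 1 + fderiv ℝ q z Complex.I) =
      - ∫ z in disc, (p z * (G z).re + q z * (G z).im) := by
  obtain ⟨M, hM0, hM⟩ := exists_bound_deriv_smoothTransition
  have cp := hp.continuous_fderiv (by simp)
  have cq := hq.continuous_fderiv (by simp)
  set d : ℂ → ℝ := fun z => fderiv ℝ p z 1 + fderiv ℝ q z Complex.I with hd
  have cd : Continuous d := (cp.clm_apply continuous_const).add (cq.clm_apply continuous_const)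
  have gre : IntegrableOn (fun z => (G z).re) disc := hG.re
  have gim : IntegrableOn (fun z => (G z).im) disc := hG.im
  set s : ℕ → ℂ → ℝ := fun n z => deriv Real.smoothTransition (n * (1 - ‖z‖ ^ 2) - 1) with hs
  set e : ℕ → ℂ → ℝ := fun n z => -2 * n * s n z * (z.re * p z + z.im * q z) with he
  have cs : ∀ n, Continuous (s n) := fun n => by
    have : Continuous (deriv Real.smoothTransition) :=
      (Real.smoothTransition.contDiff (n := 1)).continuous_deriv (by simp)
    exact this.comp (by fun_prop)
  have ce : ∀ n, Continuous (e n) := fun n => by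
    have := cs n
    have := hp.continuous
    have := hq.continuous
    fun_prop
  have step : ∀ n : ℕ, 0 < n →
      ∫ z in disc, u z * (discCutoff n z * d z + e n z) =
        - ∫ z in disc, discCutoff n z * (p z * (G z).re + q z * (G z).im) := by
    intro n hn
    have cχ := (contDiff_discCutoff n).continuous
    have cχ' := (contDiff_discCutoff n).continuous_fderiv (by simp)
    have k1 := h.integral_cutoff hu hG hp hn 1
    have k2 := h.integral_cutoff hu hG hq hn Complex.I
    have key := congrArg₂ (· + ·) k1 k2
    have c1 := hp.continuous
    have c2 := hq.continuous
    rw [← neg_add, ← integral_add, ← integral_add] at key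
    · refine Eq.trans ?_ (key.trans (congrArg Neg.neg ?_))
      · congr 1
        ext z
        rw [fderiv_discCutoff, fderiv_discCutoff]
        simp [hd, he, hs, Complex.inner]
        ring
      · congr 1
        ext z
        simp [Complex.inner]
        ring
    · refine (integrable_disc_mul gre (cχ.mul c1)).congr (Filter.Eventually.of_forall fun z => ?_)
      simp [Complex.inner, mul_comm]
    · refine (integrable_disc_mul gim (cχ.mul c2)).congr (Filter.Eventually.of_forall fun z => ?_)
      simp [Complex.inner, mul_comm]
    · exact integrable_disc_mul hu (by fun_prop)
    · exact integrable_disc_mul hu (by fun_prop)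
  have be : ∀ n, ∀ z ∈ disc, |e n z| ≤ 4 * M * C := by
    intro n z hz
    have hpos : 0 ≤ 1 - ‖z‖ ^ 2 := by
      have := mem_disc_iff.1 hz
      nlinarith [norm_nonneg z]
    have hn0 : (0 : ℝ) ≤ n := n.cast_nonneg
    have hC' := hC z hz
    have hCn : 0 ≤ C * (1 - ‖z‖ ^ 2) := (abs_nonneg _).trans hC'
    have hC0 : 0 ≤ C := by
      have := mem_disc_iff.1 hz
      have : 0 < 1 - ‖z‖ ^ 2 := by nlinarith [norm_nonneg z]
      exact nonneg_of_mul_nonneg_left hCn this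
    by_cases hx : 1 < n * (1 - ‖z‖ ^ 2) - 1
    · simp only [he, hs, deriv_smoothTransition_eq_zero (Or.inr hx)]
      simp
      positivity
    · simp only [he, abs_mul, abs_neg, abs_two, abs_of_nonneg hn0]
      calc 2 * n * |s n z| * |z.re * p z + z.im * q z|
          ≤ 2 * n * M * (C * (1 - ‖z‖ ^ 2)) := by
            gcongr
            exact hM _
        _ = 2 * M * C * (n * (1 - ‖z‖ ^ 2)) := by ring
        _ ≤ 2 * M * C * 2 := by gcongr; linarith
        _ = 4 * M * C := by ring
  have lim1 : Filter.Tendsto (fun n : ℕ => ∫ z in disc, u z * (discCutoff n z * d z + e n z))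
      Filter.atTop (nhds (∫ z in disc, u z * d z)) := by
    refine tendsto_integral_of_dominated_convergence
      (fun z => |u z| * (|d z| + 4 * M * C)) ?_ ?_ ?_ ?_
    · intro n
      have cχ := (contDiff_discCutoff n).continuous
      exact (integrable_disc_mul hu ((cχ.mul cd).add (ce n))).aestronglyMeasurable
    · exact integrable_disc_mul hu.abs (cd.abs.add continuous_const)
    · intro n
      filter_upwards [ae_restrict_mem measurableSet_disc] with z hz
      rw [norm_mul, Real.norm_eq_abs, Real.norm_eq_abs]
      gcongr
      refine (abs_add_le _ _).trans (add_le_add ?_ (be n z hz))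
      rw [abs_mul]
      refine mul_le_of_le_one_left (abs_nonneg _) ?_
      rw [discCutoff, abs_of_nonneg (Real.smoothTransition.nonneg _)]
      exact Real.smoothTransition.le_one _
    · filter_upwards [ae_restrict_mem measurableSet_disc] with z hz
      refine tendsto_const_nhds.congr' ?_
      filter_upwards [eventually_two_lt_mul_one_sub_sq hz] with n hn
      have : discCutoff n z = 1 := Real.smoothTransition.one_of_one_le (by linarith)
      simp only [he, hs, this, deriv_smoothTransition_eq_zero (Or.inr (by linarith : (1:ℝ) <
        n * (1 - ‖z‖ ^ 2) - 1))]
      ring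
  have lim2 : Filter.Tendsto
      (fun n : ℕ => - ∫ z in disc, discCutoff n z * (p z * (G z).re + q z * (G z).im))
      Filter.atTop (nhds (- ∫ z in disc, (p z * (G z).re + q z * (G z).im))) := by
    have iG : IntegrableOn (fun z => p z * (G z).re + q z * (G z).im) disc := by
      have i1 := integrable_disc_mul gre hp.continuous
      have i2 := integrable_disc_mul gim hq.continuous
      exact (i1.add i2).congr (Filter.Eventually.of_forall fun z => by simp [mul_comm])
    refine Filter.Tendsto.neg (tendsto_integral_of_dominated_convergence
      (fun z => |p z * (G z).re + q z * (G z).im|) ?_ iG.abs ?_ ?_)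
    · intro n
      exact (contDiff_discCutoff n).continuous.aestronglyMeasurable.mul iG.aestronglyMeasurable
    · intro n
      refine Filter.Eventually.of_forall fun z => ?_
      rw [norm_mul, Real.norm_eq_abs, Real.norm_eq_abs]
      refine mul_le_of_le_one_left (abs_nonneg _) ?_
      rw [discCutoff, abs_of_nonneg (Real.smoothTransition.nonneg _)]
      exact Real.smoothTransition.le_one _
    · filter_upwards [ae_restrict_mem measurableSet_disc] with z hz
      refine tendsto_const_nhds.congr' ?_
      filter_upwards [eventually_two_lt_mul_one_sub_sq hz] with n hn
      have : discCutoff n z = 1 := Real.smoothTransition.one_of_one_le (by linarith)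
      rw [this, one_mul]
  refine tendsto_nhds_unique lim1 (lim2.congr' ?_)
  filter_upwards [Filter.eventually_gt_atTop 0] with n hn
  exact (step n hn).symm

/-! ### Uniqueness -/

/-- The real-valued polynomial `Re (c z^j z̄^k)`. -/
def reMonomial (j k : ℕ) (c : ℂ) (z : ℂ) : ℝ := (c * z ^ j * (starRingEnd ℂ z) ^ k).re

theorem contDiff_reMonomial (j k : ℕ) (c : ℂ) : ContDiff ℝ ∞ (reMonomial j k c) := by
  have h1 : ContDiff ℝ ∞ (fun z : ℂ => starRingEnd ℂ z) := Complex.conjCLE.contDiff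
  have h2 : ContDiff ℝ ∞ (fun z : ℂ => c * z ^ j * (starRingEnd ℂ z) ^ k) :=
    (contDiff_const.mul (contDiff_id.pow j)).mul (h1.pow k)
  exact Complex.reCLM.contDiff.comp h2

theorem fderiv_reMonomial (j k : ℕ) (c z v : ℂ) :
    fderiv ℝ (reMonomial j k c) z v =
      reMonomial (j - 1) k (c * j * v) z + reMonomial j (k - 1) (c * k * starRingEnd ℂ v) z := by
  have h1 : HasFDerivAt (fun z : ℂ => starRingEnd ℂ z) (Complex.conjCLE : ℂ →L[ℝ] ℂ) z :=
    Complex.conjCLE.hasFDerivAt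
  have h2 := ((hasFDerivAt_id (𝕜 := ℝ) z).pow j).const_mul c
  have h3 := Complex.reCLM.hasFDerivAt.comp z (h2.mul (h1.pow k))
  have h4 : HasFDerivAt (reMonomial j k c) _ z := h3
  rw [h4.fderiv]
  simp only [reMonomial, ← Complex.add_re]
  simp
  ring

theorem fderiv_fderiv_reMonomial (j k : ℕ) (c z v : ℂ) :
    fderiv ℝ (fun w => fderiv ℝ (reMonomial j k c) w v) z v =
      reMonomial (j - 2) k (c * j * (j - 1 : ℕ) * v ^ 2) z +
      reMonomial (j - 1) (k - 1) (2 * c * j * k * (v * starRingEnd ℂ v)) z +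
      reMonomial j (k - 2) (c * k * (k - 1 : ℕ) * (starRingEnd ℂ v) ^ 2) z := by
  have h : (fun w => fderiv ℝ (reMonomial j k c) w v) = fun w =>
      reMonomial (j - 1) k (c * j * v) w + reMonomial j (k - 1) (c * k * starRingEnd ℂ v) w :=
    funext fun w => fderiv_reMonomial j k c w v
  rw [h, fderiv_fun_add ((contDiff_reMonomial _ _ _).differentiable (by simp) z)
    ((contDiff_reMonomial _ _ _).differentiable (by simp) z), add_apply,
    fderiv_reMonomial, fderiv_reMonomial]
  simp only [reMonomial, ← Complex.add_re, Nat.sub_sub]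
  congr 1
  ring

/-- `Δ Re (c z^j z̄^k) = Re (4 j k c z^(j-1) z̄^(k-1))`. -/
theorem laplacian_reMonomial (j k : ℕ) (c z : ℂ) :
    fderiv ℝ (fun w => fderiv ℝ (reMonomial j k c) w 1) z 1 +
      fderiv ℝ (fun w => fderiv ℝ (reMonomial j k c) w Complex.I) z Complex.I =
      reMonomial (j - 1) (k - 1) (4 * j * k * c) z := by
  rw [fderiv_fderiv_reMonomial, fderiv_fderiv_reMonomial]
  simp only [reMonomial, ← Complex.add_re]
  congr 1
  simp
  ring

/-- The radial derivative of `Re (c z^j z̄^k)` is `(j + k) Re (c z^j z̄^k)`. -/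
theorem fderiv_reMonomial_self (j k : ℕ) (c z : ℂ) :
    fderiv ℝ (reMonomial j k c) z z = (j + k) * reMonomial j k c z := by
  rw [fderiv_reMonomial]
  have e : ∀ (n : ℕ) (w : ℂ), (n : ℂ) * w * w ^ (n - 1) = n * w ^ n := by
    intro n w
    cases n with
    | zero => simp
    | succ n => simp [pow_succ]; ring
  have h : ((j : ℝ) + k) * reMonomial j k c z =
      (((j + k : ℝ) : ℂ) * (c * z ^ j * (starRingEnd ℂ z) ^ k)).re := by
    rw [Complex.re_ofReal_mul, reMonomial]
  rw [h]
  simp only [reMonomial, ← Complex.add_re]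
  congr 1
  push_cast
  linear_combination c * (starRingEnd ℂ z) ^ k * e j z + c * z ^ j * e k (starRingEnd ℂ z)

/-- If `G = ∇u` is orthogonal to all gradients of smooth functions, then `u` is orthogonal to the
Laplacian of any smooth `ζ` whose radial derivative is `O(1 - ‖z‖²)`, i.e. vanishes on the
circle. -/
theorem IsWeakGradient.integral_mul_laplacian {u : ℂ → ℝ} {G : ℂ → ℂ} (h : IsWeakGradient u G)
    (hu : IntegrableOn u disc) (hG : IntegrableOn G disc)
    (hN : ∀ ζ : ℂ → ℝ, ContDiff ℝ ∞ ζ → ∫ z in disc, inner ℝ (G z) (gradient ζ z) = 0)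
    {ζ : ℂ → ℝ} (hζ : ContDiff ℝ ∞ ζ) {C : ℝ}
    (hC : ∀ z ∈ disc, |fderiv ℝ ζ z z| ≤ C * (1 - ‖z‖ ^ 2)) :
    ∫ z in disc, u z * (fderiv ℝ (fun w => fderiv ℝ ζ w 1) z 1 +
      fderiv ℝ (fun w => fderiv ℝ ζ w Complex.I) z Complex.I) = 0 := by
  have cf : ContDiff ℝ ∞ (fderiv ℝ ζ) := hζ.fderiv_right (by simp)
  rw [h.integral_tangential hu hG (cf.clm_apply contDiff_const) (cf.clm_apply contDiff_const)
    (C := C), neg_eq_zero, ← hN ζ hζ]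
  · congr 1
    ext z
    simp only [gradient_eq_mk, Complex.inner, Complex.mul_re, Complex.conj_re, Complex.conj_im]
    ring
  · intro z hz
    refine le_trans (le_of_eq ?_) (hC z hz)
    congr 1
    conv_rhs => rw [show fderiv ℝ ζ z z = fderiv ℝ ζ z (z.re • (1 : ℂ) + z.im • Complex.I) by
      congr 1; apply Complex.ext <;> simp]
    simp only [map_add, map_smul, smul_eq_mul]

theorem reMonomial_conj (j k : ℕ) (c z : ℂ) :
    reMonomial j k c z = reMonomial k j (starRingEnd ℂ c) z := by
  rw [reMonomial, reMonomial, ← Complex.conj_re]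
  congr 1
  simp
  ring

theorem reMonomial_smul (j k : ℕ) (t : ℝ) (c z : ℂ) :
    reMonomial j k (t * c) z = t * reMonomial j k c z := by
  simp only [reMonomial, mul_assoc, Complex.re_ofReal_mul]

theorem reMonomial_add_diag (m k : ℕ) (c z : ℂ) :
    reMonomial (m + k) k c z = ‖z‖ ^ (2 * k) * reMonomial m 0 c z := by
  have : c * z ^ (m + k) * (starRingEnd ℂ z) ^ k =
      ((‖z‖ ^ (2 * k) : ℝ) : ℂ) * (c * z ^ m * (starRingEnd ℂ z) ^ 0) := by
    push_cast
    rw [pow_mul, ← Complex.mul_conj', mul_pow]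
    ring
  rw [reMonomial, this, Complex.re_ofReal_mul, reMonomial]

theorem abs_reMonomial_le (j k : ℕ) (c : ℂ) {z : ℂ} (hz : z ∈ disc) :
    |reMonomial j k c z| ≤ ‖c‖ := by
  have h := (mem_disc_iff.1 hz).le
  refine (Complex.abs_re_le_norm _).trans ?_
  rw [norm_mul, norm_mul, norm_pow, norm_pow, Complex.norm_conj, mul_assoc]
  refine mul_le_of_le_one_right (norm_nonneg _) ?_
  exact mul_le_one₀ (pow_le_one₀ (norm_nonneg _) h) (by positivity)
    (pow_le_one₀ (norm_nonneg _) h)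

/-- Bernoulli's inequality in the form `1 - x^n ≤ n (1 - x)`. -/
theorem one_sub_pow_le {x : ℝ} (h0 : 0 ≤ x) (n : ℕ) : 1 - x ^ n ≤ n * (1 - x) := by
  have := one_add_mul_le_pow (a := x - 1) (by linarith) n
  simp only [add_sub_cancel] at this
  linarith

/-- If `G = ∇u` is orthogonal to all gradients of smooth functions and `u` has mean zero, then `u`
is orthogonal to all monomials. For `Re (c z^(m+k) z̄^k)` with `m > 0` the test function is the
particular solution `Re (c z^(m+k+1) z̄^(k+1))` of the Poisson equation, corrected by a multiple of
the harmonic function `Re (c z^m)` that cancels its radial derivative on the circle; for `m = 0`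
the correction is a multiple of `‖z‖²`, whose constant Laplacian is harmless because the mean of
`u` is zero. -/
theorem integral_mul_reMonomial_eq_zero {u : ℂ → ℝ} {G : ℂ → ℂ} (h : IsWeakGradient u G)
    (hu : IntegrableOn u disc) (hG : IntegrableOn G disc)
    (hN : ∀ ζ : ℂ → ℝ, ContDiff ℝ ∞ ζ → ∫ z in disc, inner ℝ (G z) (gradient ζ z) = 0)
    (h0 : ∫ z in disc, u z = 0) (j k : ℕ) (c : ℂ) :
    ∫ z in disc, u z * reMonomial j k c z = 0 := by
  wlog hjk : k ≤ j generalizing j k c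
  · simp only [reMonomial_conj j k]
    exact this k j _ (le_of_not_ge hjk)
  obtain ⟨m, rfl⟩ := Nat.exists_eq_add_of_le' hjk
  -- The correcting term is `- t Re (c z^m' z̄^k')`; `ht` makes the radial derivatives cancel.
  have main : ∀ (m' k' : ℕ) (t : ℝ), (∀ z, reMonomial m' k' c z = ‖z‖ ^ (2 * k') *
        reMonomial m 0 c z) →
      (m + 2 * k + 2 : ℝ) = t * (m' + k') → k' ≤ k + 1 →
      ∫ z in disc, u z * (4 * (m + k + 1) * (k + 1) * reMonomial (m + k) k c z -
        t * reMonomial (m' - 1) (k' - 1) (4 * m' * k' * c) z) = 0 := by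
    intro m' k' t he ht hk'
    set f := reMonomial (m + k + 1) (k + 1) c with hf
    set g := reMonomial m' k' c with hg
    have cf : ContDiff ℝ ∞ f := contDiff_reMonomial _ _ _
    have cg : ContDiff ℝ ∞ g := contDiff_reMonomial _ _ _
    have df := fun z => cf.differentiable (by simp) z
    have dg := fun z => cg.differentiable (by simp) z
    have hD : ∀ z v, fderiv ℝ (fun z => f z - t * g z) z v =
        fderiv ℝ f z v - t * fderiv ℝ g z v := by
      intro z v
      rw [fderiv_fun_sub (df z) ((dg z).const_mul t), fderiv_const_mul (dg z)]
      simp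
    have df' : ∀ z v, DifferentiableAt ℝ (fun w => fderiv ℝ f w v) z := fun z v =>
      ((cf.fderiv_right (m := ∞) (by simp)).clm_apply contDiff_const).differentiable (by simp) z
    have dg' : ∀ z v, DifferentiableAt ℝ (fun w => fderiv ℝ g w v) z := fun z v =>
      ((cg.fderiv_right (m := ∞) (by simp)).clm_apply contDiff_const).differentiable (by simp) z
    have hDD : ∀ z v, fderiv ℝ (fun w => fderiv ℝ (fun z => f z - t * g z) w v) z v =
        fderiv ℝ (fun w => fderiv ℝ f w v) z v - t * fderiv ℝ (fun w => fderiv ℝ g w v) z v := by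
      intro z v
      simp only [hD]
      rw [fderiv_fun_sub (df' z v) ((dg' z v).const_mul t), fderiv_const_mul (dg' z v)]
      simp
    have key := h.integral_mul_laplacian hu hG hN (ζ := fun z => f z - t * g z)
      (C := (m + 2 * k + 2) * ((k + 1) * ‖c‖)) (cf.sub (contDiff_const.mul cg)) ?_
    · rw [← key]
      congr 1
      ext z
      congr 1
      rw [hDD, hDD]
      have e1 := laplacian_reMonomial (m + k + 1) (k + 1) c z
      have e2 := laplacian_reMonomial m' k' c z
      rw [← hf] at e1
      rw [← hg] at e2
      rw [← e2]
      have e3 : reMonomial (m + k + 1 - 1) (k + 1 - 1)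
          (4 * ((m + k + 1 : ℕ) : ℂ) * ((k + 1 : ℕ) : ℂ) * c) z =
          4 * (m + k + 1) * (k + 1) * reMonomial (m + k) k c z := by
        rw [← reMonomial_smul]
        push_cast
        rfl
      rw [← e3, ← e1]
      ring
    · intro z hz
      have hz1 := (mem_disc_iff.1 hz).le
      have hx0 : 0 ≤ ‖z‖ ^ 2 := by positivity
      have hx1 : ‖z‖ ^ 2 ≤ 1 := pow_le_one₀ (norm_nonneg _) hz1
      have e : fderiv ℝ (fun z => f z - t * g z) z z =
          -((m + 2 * k + 2) * (((‖z‖ ^ 2) ^ k' - (‖z‖ ^ 2) ^ (k + 1)) * reMonomial m 0 c z)) := by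
        have e1 : f z = (‖z‖ ^ 2) ^ (k + 1) * reMonomial m 0 c z := by
          rw [← pow_mul, ← reMonomial_add_diag]
          rfl
        rw [hD, fderiv_reMonomial_self, fderiv_reMonomial_self, ← hf, ← hg, e1, he, pow_mul]
        push_cast
        linear_combination (‖z‖ ^ 2) ^ k' * reMonomial m 0 c z * ht
      have hpow : (‖z‖ ^ 2) ^ (k + 1) ≤ (‖z‖ ^ 2) ^ k' := pow_le_pow_of_le_one hx0 hx1 hk'
      have hd : (‖z‖ ^ 2) ^ k' - (‖z‖ ^ 2) ^ (k + 1) ≤ (k + 1) * (1 - ‖z‖ ^ 2) := by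
        have := one_sub_pow_le hx0 (k + 1)
        have h1 : (‖z‖ ^ 2) ^ k' ≤ 1 := pow_le_one₀ hx0 hx1
        push_cast at this
        linarith
      rw [e, abs_neg, abs_mul, abs_mul, abs_of_nonneg (sub_nonneg.2 hpow),
        abs_of_nonneg (by positivity : (0 : ℝ) ≤ m + 2 * k + 2)]
      calc (m + 2 * k + 2 : ℝ) * (((‖z‖ ^ 2) ^ k' - (‖z‖ ^ 2) ^ (k + 1)) * |reMonomial m 0 c z|)
          ≤ (m + 2 * k + 2) * (((k + 1) * (1 - ‖z‖ ^ 2)) * ‖c‖) := by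
            gcongr
            exact abs_reMonomial_le _ _ _ hz
        _ = _ := by ring
  have hc : (4 * (m + k + 1) * (k + 1) : ℝ) ≠ 0 := by positivity
  have iM : ∀ j k c, IntegrableOn (fun z => u z * reMonomial j k c z) disc := fun j k c =>
    integrable_disc_mul hu (contDiff_reMonomial _ _ _).continuous
  have fin : ∫ z in disc,
      (4 * (m + k + 1) * (k + 1) : ℝ) * (u z * reMonomial (m + k) k c z) = 0 := by
    rcases Nat.eq_zero_or_pos m with rfl | hm
    · have hs := main 1 1 (k + 1) (fun z => by
        simpa using reMonomial_add_diag 0 1 c z) (by push_cast; ring) (by omega)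
      rw [← hs, ← sub_eq_zero, ← integral_sub ((iM _ _ _).const_mul _)]
      · have : ∀ z, 4 * (((0 : ℕ) : ℝ) + k + 1) * (k + 1) * (u z * reMonomial (0 + k) k c z) -
            u z * (4 * (((0 : ℕ) : ℝ) + k + 1) * (k + 1) * reMonomial (0 + k) k c z -
              ((k : ℝ) + 1) * reMonomial (1 - 1) (1 - 1) (4 * (1 : ℕ) * (1 : ℕ) * c) z) =
            u z * (((k : ℝ) + 1) * (4 * c).re) := by
          intro z
          simp [reMonomial]
          ring
        simp only [this]
        rw [integral_mul_const, h0, zero_mul]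
      · refine integrable_disc_mul hu ?_
        exact ((contDiff_reMonomial _ _ _).continuous.const_mul _).sub
          ((contDiff_reMonomial _ _ _).continuous.const_mul _)
    · have hm' : (m : ℝ) ≠ 0 := by positivity
      have hs := main m 0 ((m + 2 * k + 2) / m) (fun z => by simp) (by
        push_cast; field_simp; ring) (by omega)
      rw [← hs]
      congr 1
      ext z
      simp [reMonomial]
      ring
  rw [integral_const_mul] at fin
  exact (mul_eq_zero.1 fin).resolve_left hc

/-- An integrable function on the disc that is orthogonal to all polynomials in `z`, `z̄` vanishes
almost everywhere, by the Stone–Weierstrass theorem on the closed disc. -/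
theorem ae_eq_zero_of_integral_mul_reMonomial {u : ℂ → ℝ} (hu : IntegrableOn u disc)
    (h : ∀ (j k : ℕ) (c : ℂ), ∫ z in disc, u z * reMonomial j k c z = 0) :
    u =ᵐ[volume.restrict disc] 0 := by
  have hK : IsCompact (Metric.closedBall (0 : ℂ) 1) := isCompact_closedBall 0 1
  set K := Metric.closedBall (0 : ℂ) 1 with hKdef
  have : CompactSpace K := isCompact_iff_compactSpace.1 hK
  have dK : disc ⊆ K := Metric.ball_subset_closedBall
  -- The elements of the dense subalgebra are the restrictions of functions orthogonal to `u`.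
  have poly : ∀ f ∈ (polynomialFunctions K).starClosure, ∃ P : ℂ → ℂ, Continuous P ∧
      (∀ z : K, f z = P z) ∧ ∀ c : ℂ, ∫ z in disc, u z * (c * P z).re = 0 := by
    intro f hf
    rw [polynomialFunctions.starClosure_eq_adjoin_X, ← StarSubalgebra.mem_toSubalgebra,
      StarAlgebra.adjoin_toSubalgebra, ← Subalgebra.mem_toSubmodule, Algebra.adjoin_eq_span] at hf
    induction hf using Submodule.span_induction with
    | mem f hf =>
      rw [star_singleton, singleton_union, Polynomial.toContinuousMapOnAlgHom_apply] at hf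
      obtain ⟨j, k, rfl⟩ := (Submonoid.mem_closure_pair ..).1 hf
      refine ⟨fun z => z ^ j * (starRingEnd ℂ z) ^ k, ?_, fun z => ?_, fun c => ?_⟩
      · exact (continuous_pow j).mul (Complex.continuous_conj.pow k)
      · simp
      · simpa [reMonomial, mul_assoc] using h j k c
    | zero => exact ⟨0, continuous_zero, by simp, by simp⟩
    | add f g _ _ hf hg =>
      obtain ⟨P, cP, eP, iP⟩ := hf
      obtain ⟨Q, cQ, eQ, iQ⟩ := hg
      refine ⟨P + Q, cP.add cQ, fun z => by simp [eP, eQ], fun c => ?_⟩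
      have e : ∀ z, u z * (c * (P + Q) z).re = u z * (c * P z).re + u z * (c * Q z).re :=
        fun z => by simp [mul_add]
      simp only [e]
      rw [integral_add, iP, iQ, add_zero]
      · exact integrable_disc_mul hu (Complex.continuous_re.comp (cP.const_mul c))
      · exact integrable_disc_mul hu (Complex.continuous_re.comp (cQ.const_mul c))
    | smul a f _ hf =>
      obtain ⟨P, cP, eP, iP⟩ := hf
      refine ⟨fun z => a * P z, cP.const_mul a, fun z => by simp [eP], fun c => ?_⟩
      simpa [mul_assoc] using iP (c * a)
  have test : ∀ g : ℂ → ℝ, Continuous g → ∫ z in disc, u z * g z = 0 := by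
    intro g cg
    set f : C(K, ℂ) := ⟨fun z => (g z : ℂ), by fun_prop⟩ with hf
    have hfc : f ∈ (polynomialFunctions K).starClosure.topologicalClosure := by
      rw [polynomialFunctions.starClosure_topologicalClosure]; trivial
    have hfc' : f ∈ closure ((polynomialFunctions K).starClosure : Set C(K, ℂ)) := hfc
    rw [Metric.mem_closure_iff] at hfc'
    set N := ∫ z in disc, |u z| with hN
    have hN0 : 0 ≤ N := integral_nonneg fun _ => abs_nonneg _
    have bound : ∀ ε > 0, |∫ z in disc, u z * g z| ≤ ε * N := by
      intro ε hε
      obtain ⟨q, hq, hd⟩ := hfc' ε hε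
      obtain ⟨P, cP, eP, iP⟩ := poly q hq
      have iP1 := iP 1
      simp only [one_mul] at iP1
      have e : ∫ z in disc, u z * g z = ∫ z in disc, u z * (g z - (P z).re) := by
        have hs := integral_sub (integrable_disc_mul hu cg)
          (integrable_disc_mul hu (f := fun z => (P z).re) (Complex.continuous_re.comp cP))
        rw [iP1, sub_zero] at hs
        simp only [mul_sub, hs]
      rw [e, hN, ← integral_const_mul, ← Real.norm_eq_abs]
      refine norm_integral_le_of_norm_le (hu.abs.const_mul ε) ?_
      filter_upwards [ae_restrict_mem measurableSet_disc] with z hz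
      rw [norm_mul, mul_comm, Real.norm_eq_abs, Real.norm_eq_abs]
      gcongr
      have h1 := (ContinuousMap.dist_apply_le_dist (f := f) (g := q) ⟨z, dK hz⟩).trans hd.le
      rw [eP, Complex.dist_eq] at h1
      refine le_trans ?_ h1
      simpa [hf] using Complex.abs_re_le_norm ((g z : ℂ) - P z)
    rw [← abs_eq_zero]
    refine le_antisymm (le_of_forall_pos_le_add fun ε hε => ?_) (abs_nonneg _)
    refine (bound (ε / (N + 1)) (by positivity)).trans ?_
    rw [zero_add, div_mul_eq_mul_div, div_le_iff₀ (by positivity)]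
    nlinarith
  have key := Metric.isOpen_ball.ae_eq_zero_of_integral_contDiff_smul_eq_zero (U := disc)
    (μ := volume) (f := u) hu.locallyIntegrableOn (by
      intro g hg _ hs
      rw [← setIntegral_eq_integral_of_forall_compl_eq_zero (s := disc)]
      · simpa only [smul_eq_mul, mul_comm] using test g hg.continuous
      · intro z hz
        simp [image_eq_zero_of_notMem_tsupport (fun hh => hz (hs hh))])
  rw [Filter.EventuallyEq, ae_restrict_iff' measurableSet_disc]
  exact key

theorem IsWeakGradient.sub {u v : ℂ → ℝ} {G H : ℂ → ℂ} (hu : IsWeakGradient u G)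
    (hv : IsWeakGradient v H) (iu : IntegrableOn u disc) (iv : IntegrableOn v disc)
    (iG : IntegrableOn G disc) (iH : IntegrableOn H disc) :
    IsWeakGradient (fun z => u z - v z) (fun z => G z - H z) := by
  refine ⟨hu.locallyIntegrable.sub hv.locallyIntegrable,
    hu.locallyIntegrable_grad.sub hv.locallyIntegrable_grad, fun η hη hc hs => ?_⟩
  obtain ⟨C, hC⟩ := (continuous_gradient hη).bounded_above_of_compact_support
    ((hc.fderiv ℝ).comp_left (g := (InnerProductSpace.toDual ℝ ℂ).symm) (by simp))
  obtain ⟨C', hC'⟩ := hη.continuous.bounded_above_of_compact_support hc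
  have i1 : ∀ {w : ℂ → ℝ}, IntegrableOn w disc →
      IntegrableOn (fun z => w z • gradient η z) disc := fun hw =>
    hw.smul_bdd C (continuous_gradient hη).aestronglyMeasurable (Filter.Eventually.of_forall hC)
  have i2 : ∀ {W : ℂ → ℂ}, IntegrableOn W disc → IntegrableOn (fun z => η z • W z) disc :=
    fun hW => hW.bdd_smul C' hη.continuous.aestronglyMeasurable (Filter.Eventually.of_forall hC')
  simp only [sub_smul, smul_sub]
  rw [integral_sub (i1 iu) (i1 iv), integral_sub (i2 iG) (i2 iH), hu.integral_eq η hη hc hs,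
    hv.integral_eq η hη hc hs]
  abel

theorem MemW1.integrableOn {u : ℂ → ℝ} (h : MemW1 1 u) : IntegrableOn u disc :=
  memLp_one_iff_integrable.1 h.1

theorem MemW1.integrableOn_weakGrad {u : ℂ → ℝ} (h : MemW1 1 u) :
    IntegrableOn (weakGrad u) disc := by
  obtain ⟨-, G, hG, iG⟩ := h
  exact (memLp_one_iff_integrable.1 iG).congr (weakGrad_ae_eq hG).symm

theorem MemW1.isWeakGradient_weakGrad {p : ℝ≥0∞} {u : ℂ → ℝ} (h : MemW1 p u) :
    IsWeakGradient u (weakGrad u) := by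
  obtain ⟨-, G, hG, -⟩ := h
  exact weakGrad_spec hG

/-- The Neumann problem has at most one solution of zero mean in `W^{1,1}`, for any data. -/
theorem IsZeroMeanNeumannSolution.ae_eq {a b φ ψ : ℂ → ℝ} (hφ : IsZeroMeanNeumannSolution a b φ)
    (hψ : IsZeroMeanNeumannSolution a b ψ) : φ =ᵐ[volume.restrict disc] ψ := by
  have iφ := hφ.memW1.integrableOn
  have iψ := hψ.memW1.integrableOn
  have iG := hφ.memW1.integrableOn_weakGrad
  have iH := hψ.memW1.integrableOn_weakGrad
  have hw := hφ.memW1.isWeakGradient_weakGrad.sub hψ.memW1.isWeakGradient_weakGrad iφ iψ iG iH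
  have i1 : ∀ {W : ℂ → ℂ} {ζ : ℂ → ℝ}, IntegrableOn W disc → ContDiff ℝ ∞ ζ →
      IntegrableOn (fun z => inner ℝ (W z) (gradient ζ z)) disc := by
    intro W ζ hW hζ
    have c := continuous_gradient hζ
    have h1 := integrable_disc_mul hW.re (Complex.continuous_re.comp c)
    have h2 := integrable_disc_mul hW.im (Complex.continuous_im.comp c)
    refine (h1.add h2).congr (Filter.Eventually.of_forall fun z => ?_)
    simp only [Complex.inner, Pi.add_apply, Function.comp_apply, RCLike.re_to_complex,
      RCLike.im_to_complex, Complex.mul_re, Complex.conj_re, Complex.conj_im]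
    ring
  have hz := ae_eq_zero_of_integral_mul_reMonomial (iφ.sub iψ)
    (integral_mul_reMonomial_eq_zero hw (iφ.sub iψ) (iG.sub iH) (fun ζ hζ => by
      simp only [inner_sub_left]
      rw [integral_sub (i1 iG hζ) (i1 iH hζ), hφ.weak_eq ζ hζ, hψ.weak_eq ζ hζ, sub_self]) (by
      rw [integral_sub' iφ iψ, hφ.zero_mean, hψ.zero_mean, sub_zero]))
  filter_upwards [hz] with z h
  exact sub_eq_zero.1 h

/-! ### Functions smooth in the open disc -/

theorem isOpen_disc : IsOpen disc := Metric.isOpen_ball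

theorem exists_forall_two_lt_mul_one_sub_sq {K : Set ℂ} (hK : IsCompact K) (hKd : K ⊆ disc) :
    ∃ n : ℕ, 0 < n ∧ ∀ z ∈ K, 2 < n * (1 - ‖z‖ ^ 2) := by
  have hpos : ∀ z ∈ K, 0 < 1 - ‖z‖ ^ 2 := fun z hz => by
    have := mem_disc_iff.1 (hKd hz)
    nlinarith [norm_nonneg z]
  obtain ⟨C, hC⟩ := hK.exists_bound_of_continuousOn (f := fun z : ℂ => (1 - ‖z‖ ^ 2)⁻¹)
    (ContinuousOn.inv₀ (by fun_prop) fun z hz => (hpos z hz).ne')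
  obtain ⟨n, hn⟩ := exists_nat_gt (2 * |C|)
  refine ⟨n, Nat.cast_pos.1 ((show (0 : ℝ) ≤ 2 * |C| by positivity).trans_lt hn), fun z hz => ?_⟩
  have h1 := (hC z hz).trans (le_abs_self C)
  rw [Real.norm_eq_abs, abs_of_pos (inv_pos.2 (hpos z hz)),
    inv_le_iff_one_le_mul₀ (hpos z hz)] at h1
  have := mul_lt_mul_of_pos_right hn (hpos z hz)
  linarith

/-- The classical gradient of a function that is smooth in the open disc, with no control at the
boundary, is its weak gradient. -/
theorem isWeakGradient_gradient_of_contDiffOn {u : ℂ → ℝ} (hu : ContDiffOn ℝ ∞ u disc) :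
    IsWeakGradient u (gradient u) := by
  have cf : ContinuousOn (fderiv ℝ u) disc :=
    hu.continuousOn_fderiv_of_isOpen isOpen_disc (by simp)
  have cg : ContinuousOn (gradient u) disc :=
    (InnerProductSpace.toDual ℝ ℂ).symm.continuous.comp_continuousOn cf
  refine ⟨hu.continuousOn.locallyIntegrableOn measurableSet_disc,
    cg.locallyIntegrableOn measurableSet_disc, fun η hη hc hs => ?_⟩
  obtain ⟨n, hn, hK⟩ := exists_forall_two_lt_mul_one_sub_sq hc.isCompact hs
  set w : ℂ → ℝ := fun z => discCutoff n z * u z with hw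
  have cw : ContDiff ℝ ∞ w := by
    rw [contDiff_iff_contDiffAt]
    intro z
    by_cases hz : z ∈ disc
    · exact (contDiff_discCutoff n).contDiffAt.mul (hu.contDiffAt (isOpen_disc.mem_nhds hz))
    · have h0 : w =ᶠ[nhds z] fun _ => 0 := by
        have : z ∉ tsupport (discCutoff n) := fun h => hz (tsupport_discCutoff_subset_disc hn h)
        filter_upwards [notMem_tsupport_iff_eventuallyEq.1 this] with y hy
        simp [hw, hy]
      exact contDiffAt_const.congr_of_eventuallyEq h0
  have hwu : ∀ z ∈ tsupport η, w =ᶠ[nhds z] u := by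
    intro z hz
    have c : Continuous fun z : ℂ => n * (1 - ‖z‖ ^ 2) := by fun_prop
    filter_upwards [(c.continuousAt (x := z)).eventually (lt_mem_nhds (hK z hz))] with y hy
    have : discCutoff n y = 1 := Real.smoothTransition.one_of_one_le (by linarith)
    simp [hw, this]
  have key := (isWeakGradient_gradient cw).integral_eq η hη hc hs
  have e1 : ∀ z, w z • gradient η z = u z • gradient η z := by
    intro z
    by_cases hz : z ∈ tsupport η
    · rw [(hwu z hz).eq_of_nhds]
    · have : fderiv ℝ η z = 0 :=
        image_eq_zero_of_notMem_tsupport (fun hh => hz (tsupport_fderiv_subset ℝ hh))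
      simp [gradient, this]
  have e2 : ∀ z, η z • gradient w z = η z • gradient u z := by
    intro z
    by_cases hz : z ∈ tsupport η
    · rw [gradient, gradient, (hwu z hz).fderiv_eq]
    · simp [image_eq_zero_of_notMem_tsupport hz]
  simpa only [e1, e2] using key

theorem aestronglyMeasurable_gradient {u : ℂ → ℝ} (hu : ContDiffOn ℝ ∞ u disc) :
    AEStronglyMeasurable (gradient u) (volume.restrict disc) := by
  have cf : ContinuousOn (fderiv ℝ u) disc :=
    hu.continuousOn_fderiv_of_isOpen isOpen_disc (by simp)
  exact ((InnerProductSpace.toDual ℝ ℂ).symm.continuous.comp_continuousOn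
    cf).aestronglyMeasurable measurableSet_disc

theorem gradient_comp_real {u : ℂ → ℝ} {g : ℝ → ℝ} {g' : ℝ} {z : ℂ}
    (hu : DifferentiableAt ℝ u z) (hg : HasDerivAt g g' (u z)) :
    gradient (fun w => g (u w)) z = g' • gradient u z := by
  have h := hg.comp_hasFDerivAt z hu.hasFDerivAt
  have h' : fderiv ℝ (fun w => g (u w)) z = g' • fderiv ℝ u z := h.fderiv
  rw [gradient, h', gradient]
  simp

theorem gradient_mul {u v : ℂ → ℝ} {z : ℂ} (hu : DifferentiableAt ℝ u z)
    (hv : DifferentiableAt ℝ v z) :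
    gradient (fun w => u w * v w) z = u z • gradient v z + v z • gradient u z := by
  rw [gradient, fderiv_fun_mul hu hv, gradient, gradient]
  simp

theorem perp_eq (v : ℂ) : perp v = -Complex.I * v := by
  apply Complex.ext <;> simp [perp]

theorem gradient_re_of_hasDerivAt {F : ℂ → ℂ} {F' z : ℂ} (h : HasDerivAt F F' z) :
    gradient (fun w => (F w).re) z = starRingEnd ℂ F' := by
  have h1 : HasFDerivAt (fun w => (F w).re) _ z :=
    Complex.reCLM.hasFDerivAt.comp z h.complexToReal_fderiv
  rw [gradient_eq_mk, h1.fderiv]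
  apply Complex.ext <;> simp

theorem gradient_neg_im_of_hasDerivAt {F : ℂ → ℂ} {F' z : ℂ} (h : HasDerivAt F F' z) :
    gradient (fun w => -(F w).im) z = -Complex.I * starRingEnd ℂ F' := by
  have h1 : HasFDerivAt (fun w => -(F w).im) _ z :=
    (Complex.imCLM.hasFDerivAt.comp z h.complexToReal_fderiv).neg
  rw [gradient_eq_mk, h1.fderiv]
  apply Complex.ext <;> simp

theorem memW1_of_contDiffOn {u : ℂ → ℝ} {p : ℝ≥0∞} (hu : ContDiffOn ℝ ∞ u disc)
    (h : MemLp u p (volume.restrict disc)) (h' : MemLp (gradient u) p (volume.restrict disc)) :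
    MemW1 p u :=
  ⟨h, gradient u, isWeakGradient_gradient_of_contDiffOn hu, h'⟩

/-- If `∇φ = - a ∇^⊥ b` pointwise, then `φ` solves the Neumann problem: both sides of the weak
equation are equal to `- ∫ a ∇^⊥ b · ∇ζ`, since the terms with `ζ ∇a` cancel. -/
theorem isNeumannSolution_of_gradient_eq {a b φ : ℂ → ℝ} (ha : ContDiffOn ℝ ∞ a disc)
    (hb : ContDiffOn ℝ ∞ b disc) (hφ : ContDiffOn ℝ ∞ φ disc)
    (ga : MemLp (gradient a) 2 (volume.restrict disc))
    (gb : MemLp (gradient b) 2 (volume.restrict disc))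
    (iφ : IntegrableOn φ disc) (iφ' : IntegrableOn (gradient φ) disc)
    (h : ∀ z ∈ disc, gradient φ z = -(a z • perp (gradient b z))) :
    IsNeumannSolution a b φ := by
  refine ⟨memW1_of_contDiffOn hφ (memLp_one_iff_integrable.2 iφ)
    (memLp_one_iff_integrable.2 iφ'), fun ζ hζ => ?_⟩
  have wa := weakGrad_ae_eq (isWeakGradient_gradient_of_contDiffOn ha)
  have wb := weakGrad_ae_eq (isWeakGradient_gradient_of_contDiffOn hb)
  have wφ := weakGrad_ae_eq (isWeakGradient_gradient_of_contDiffOn hφ)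
  have waζ := weakGrad_ae_eq (isWeakGradient_gradient_of_contDiffOn (ha.mul hζ.contDiffOn))
  have iJ : IntegrableOn (fun z => inner ℝ (gradient a z) (perp (gradient b z)) * ζ z) disc := by
    refine integrable_disc_mul ?_ hζ.continuous
    have gb' : MemLp (fun z => perp (gradient b z)) 2 (volume.restrict disc) := by
      simp only [perp_eq]
      exact gb.const_mul _
    have := MemLp.integrable_mul ga.norm gb'.norm
    refine this.mono (ga.1.inner gb'.1) (Filter.Eventually.of_forall fun z => ?_)
    simpa using abs_real_inner_le_norm (gradient a z) (perp (gradient b z))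
  have iφζ : IntegrableOn (fun z => inner ℝ (gradient φ z) (gradient ζ z)) disc := by
    have c := continuous_gradient hζ
    refine ((integrable_disc_mul iφ'.re (Complex.continuous_re.comp c)).add
      (integrable_disc_mul iφ'.im (Complex.continuous_im.comp c))).congr
      (Filter.Eventually.of_forall fun z => ?_)
    simp only [Complex.inner, Pi.add_apply, Function.comp_apply, RCLike.re_to_complex,
      RCLike.im_to_complex, Complex.mul_re, Complex.conj_re, Complex.conj_im]
    ring
  have e1 : ∫ z in disc, inner ℝ (weakGrad φ z) (gradient ζ z) =
      ∫ z in disc, inner ℝ (gradient φ z) (gradient ζ z) := by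
    refine integral_congr_ae ?_
    filter_upwards [wφ] with z h1
    rw [h1]
  have e2 : ∫ z in disc, jacobian a b z * ζ z =
      ∫ z in disc, inner ℝ (gradient a z) (perp (gradient b z)) * ζ z := by
    refine integral_congr_ae ?_
    filter_upwards [wa, wb] with z h1 h2
    rw [jacobian, h1, h2]
  have e3 : tangentialPairing b (fun z => a z * ζ z) =
      ∫ z in disc, (inner ℝ (gradient a z) (perp (gradient b z)) * ζ z -
        inner ℝ (gradient φ z) (gradient ζ z)) := by
    refine integral_congr_ae ?_
    filter_upwards [wb, waζ, ae_restrict_mem measurableSet_disc] with z h1 h2 hz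
    have da : DifferentiableAt ℝ a z :=
      (ha.contDiffAt (isOpen_disc.mem_nhds hz)).differentiableAt (by simp)
    have h3 : weakGrad (fun z => a z * ζ z) z = a z • gradient ζ z + ζ z • gradient a z := by
      rw [← gradient_mul da (hζ.differentiable (by simp) z)]
      exact h2
    simp only [h1, h3, h z hz, inner_add_right, inner_smul_right, inner_neg_left, inner_smul_left,
      conj_trivial]
    rw [real_inner_comm (gradient a z)]
    ring
  rw [e1, e2, e3, integral_sub iJ iφζ]
  ring

/-! ### The unbounded solution -/

/-- The holomorphic function `2 - log (1 - z)` on the disc; its real part exceeds `1`. -/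
def shiftedLog (z : ℂ) : ℂ := 2 - Complex.log (1 - z)

/-- The holomorphic function `log (2 - log (1 - z))`. On the disc it has bounded imaginary part and
finite Dirichlet integral, but its real part tends to infinity at the boundary point `1`. -/
def logLog (z : ℂ) : ℂ := Complex.log (shiftedLog z)

theorem one_sub_mem_slitPlane {z : ℂ} (hz : z ∈ disc) : 1 - z ∈ Complex.slitPlane := by
  left
  have := (Complex.re_le_norm z).trans_lt (mem_disc_iff.1 hz)
  simpa using this

theorem norm_one_sub_mem_Ioo {z : ℂ} (hz : z ∈ disc) : ‖1 - z‖ ∈ Ioo (0 : ℝ) 2 := by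
  refine ⟨norm_pos_iff.2 (Complex.slitPlane_ne_zero (one_sub_mem_slitPlane hz)), ?_⟩
  have h1 := norm_sub_le (1 : ℂ) z
  have h2 := mem_disc_iff.1 hz
  rw [norm_one] at h1
  linarith

theorem log_lt_one_of_mem_Ioo {r : ℝ} (hr : r ∈ Ioo (0 : ℝ) 2) : Real.log r < 1 := by
  have := Real.log_lt_log hr.1 hr.2
  linarith [Real.log_two_lt_d9]

theorem shiftedLog_re (z : ℂ) : (shiftedLog z).re = 2 - Real.log ‖1 - z‖ := by
  simp [shiftedLog, Complex.log_re]

theorem one_lt_shiftedLog_re {z : ℂ} (hz : z ∈ disc) : 1 < (shiftedLog z).re := by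
  rw [shiftedLog_re]
  linarith [log_lt_one_of_mem_Ioo (norm_one_sub_mem_Ioo hz)]

theorem one_lt_norm_shiftedLog {z : ℂ} (hz : z ∈ disc) : 1 < ‖shiftedLog z‖ :=
  (one_lt_shiftedLog_re hz).trans_le (Complex.re_le_norm _)

theorem hasDerivAt_logLog {z : ℂ} (hz : z ∈ disc) :
    HasDerivAt logLog ((1 - z)⁻¹ / shiftedLog z) z := by
  have h1 : HasDerivAt (fun w : ℂ => 1 - w) (-1) z := (hasDerivAt_id z).const_sub 1
  have h2 := (h1.clog (one_sub_mem_slitPlane hz)).const_sub 2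
  have h3 := h2.clog (x := z) (Or.inl (zero_lt_one.trans (one_lt_shiftedLog_re hz)))
  have h4 : HasDerivAt logLog _ z := h3
  convert h4 using 1
  simp [shiftedLog, neg_div]

theorem contDiffOn_logLog : ContDiffOn ℝ ∞ logLog disc := by
  have h : DifferentiableOn ℂ logLog disc := fun z hz =>
    (hasDerivAt_logLog hz).differentiableAt.differentiableWithinAt
  exact (h.contDiffOn isOpen_disc).restrict_scalars ℝ

/-- Integrability on the disc of functions of the distance to the boundary point `1`, in polar
coordinates around that point. -/
theorem integrableOn_disc_norm_one_sub {f : ℝ → ℝ}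
    (hf : IntegrableOn (fun r => r * f r) (Ioo 0 2)) :
    IntegrableOn (fun z : ℂ => f ‖1 - z‖) disc := by
  have h1 : IntegrableOn (fun z : ℂ => f ‖z‖) (Metric.ball 0 2) := by
    rw [integrableOn_fun_norm_addHaar]
    simpa [Complex.finrank_real_complex] using hf
  have h2 := (Measure.measurePreserving_sub_left volume (1 : ℂ)).integrableOn_comp_preimage
    (MeasurableEquiv.subLeft (1 : ℂ)).measurableEmbedding (f := fun z : ℂ => f ‖z‖)
    (s := Metric.ball 0 2)
  refine (h2.2 h1).mono_set fun z hz => ?_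
  simpa using (norm_one_sub_mem_Ioo hz).2

/-- `1 / (r (2 - log r)²)` is integrable near `0`: it is the derivative of `1 / (2 - log r)`. -/
theorem integrableOn_inv_mul_sq_log :
    IntegrableOn (fun r : ℝ => r * ((r * (2 - Real.log r))⁻¹) ^ 2) (Ioo 0 2) := by
  have hpos : ∀ r ∈ Icc (0 : ℝ) 2, r ≠ 0 → 2 - Real.log r ≠ 0 := by
    intro r hr h0
    have := Real.log_le_log (lt_of_le_of_ne hr.1 h0.symm) hr.2
    linarith [Real.log_two_lt_d9]
  -- The value at `0` has to be prescribed: `Real.log 0 = 0` would give `1 / 2`, not the limit `0`.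
  set g : ℝ → ℝ := Function.update (fun r => (2 - Real.log r)⁻¹) 0 0 with hg
  have cg : ContinuousOn g (Icc 0 2) := by
    rw [hg, continuousOn_update_iff]
    constructor
    · refine ContinuousOn.inv₀ (continuousOn_const.sub (Real.continuousOn_log.mono ?_)) ?_
      · exact fun r hr => hr.2
      · exact fun r hr => hpos r hr.1 hr.2
    · intro _
      have h1 : Filter.Tendsto (fun r => 2 - Real.log r) (nhdsWithin 0 {0}ᶜ) Filter.atTop := by
        simp only [sub_eq_add_neg]
        exact Filter.tendsto_atTop_add_const_left _ 2
          (Filter.tendsto_neg_atBot_atTop.comp Real.tendsto_log_nhdsNE_zero)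
      exact h1.inv_tendsto_atTop.mono_left (nhdsWithin_mono _ fun r hr => hr.2)
  have dg : ∀ r ∈ Ioo (0 : ℝ) 2, HasDerivAt g (r * ((r * (2 - Real.log r))⁻¹) ^ 2) r := by
    intro r hr
    have h0 := hr.1.ne'
    have h1 := hpos r (Ioo_subset_Icc_self hr) h0
    have h2 : HasDerivAt (fun r => (2 - Real.log r)⁻¹) (r * ((r * (2 - Real.log r))⁻¹) ^ 2) r := by
      refine (((Real.hasDerivAt_log h0).const_sub 2).inv h1).congr_deriv ?_
      field_simp
    refine h2.congr_of_eventuallyEq ?_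
    filter_upwards [isOpen_ne.mem_nhds h0] with s hs
    exact Function.update_of_ne hs _ _
  exact (intervalIntegral.integrableOn_deriv_of_nonneg cg dg
    fun r hr => by have := hr.1; positivity).mono_set Ioo_subset_Ioc_self

/-- The derivative of `logLog` is square integrable on the disc. -/
theorem memLp_deriv_logLog :
    MemLp (fun z => (1 - z)⁻¹ / shiftedLog z) 2 (volume.restrict disc) := by
  have hm : AEStronglyMeasurable (fun z => (1 - z)⁻¹ / shiftedLog z) (volume.restrict disc) := by
    have : Measurable fun z => (1 - z)⁻¹ / shiftedLog z := by
      unfold shiftedLog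
      fun_prop
    exact this.aestronglyMeasurable
  rw [memLp_two_iff_integrable_sq_norm hm]
  refine (integrableOn_disc_norm_one_sub (f := fun r => ((r * (2 - Real.log r))⁻¹) ^ 2)
    integrableOn_inv_mul_sq_log).integrable.mono (hm.norm.pow 2) ?_
  filter_upwards [ae_restrict_mem measurableSet_disc] with z hz
  have h1 := (norm_one_sub_mem_Ioo hz).1
  have h2 := one_lt_shiftedLog_re hz
  have h3 := Complex.re_le_norm (shiftedLog z)
  rw [Real.norm_eq_abs, Real.norm_eq_abs, abs_of_nonneg (by positivity),
    abs_of_nonneg (by positivity), norm_div, norm_inv, div_eq_mul_inv, ← mul_inv,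
    ← shiftedLog_re]
  gcongr

theorem logLog_re (z : ℂ) : (logLog z).re = Real.log ‖shiftedLog z‖ := Complex.log_re _

theorem abs_logLog_re_le {z : ℂ} (hz : z ∈ disc) :
    |(logLog z).re| ≤ ‖1 - z‖⁻¹ + (1 + Real.pi) := by
  have h1 := one_lt_norm_shiftedLog hz
  rw [logLog_re, abs_of_nonneg (Real.log_nonneg h1.le)]
  have h2 := Real.log_le_sub_one_of_pos (zero_lt_one.trans h1)
  have h3 := Complex.norm_le_abs_re_add_abs_im (shiftedLog z)
  rw [abs_of_pos (zero_lt_one.trans (one_lt_shiftedLog_re hz)), shiftedLog_re] at h3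
  have h4 : |(shiftedLog z).im| ≤ Real.pi := by
    simpa [shiftedLog, Complex.log_im] using Complex.abs_arg_le_pi (1 - z)
  have h5 := Real.one_sub_inv_le_log_of_pos (norm_one_sub_mem_Ioo hz).1
  linarith

theorem integrableOn_logLog_re : IntegrableOn (fun z => (logLog z).re) disc := by
  have h := integrableOn_disc_norm_one_sub (f := fun r => r⁻¹ + (1 + Real.pi)) (by
    have : IntegrableOn (fun r : ℝ => 1 + r * (1 + Real.pi)) (Ioo 0 2) :=
      (Continuous.integrableOn_Icc (by fun_prop)).mono_set Ioo_subset_Icc_self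
    refine this.congr_fun (fun r hr => ?_) measurableSet_Ioo
    have := hr.1.ne'
    field_simp)
  refine Integrable.mono' h ?_ ?_
  · exact (Complex.continuous_re.comp_continuousOn
      contDiffOn_logLog.continuousOn).aestronglyMeasurable measurableSet_disc
  · filter_upwards [ae_restrict_mem measurableSet_disc] with z hz
    exact abs_logLog_re_le hz

theorem exists_lt_logLog_re (M : ℝ) : ∃ z ∈ disc, M < (logLog z).re := by
  wlog hM : 0 ≤ M generalizing M
  · obtain ⟨z, hz, h⟩ := this 0 le_rfl
    exact ⟨z, hz, (not_le.1 hM).trans h⟩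
  -- The point is chosen so that `2 - log (1 - z) = exp (M + 1)`.
  set t : ℝ := Real.exp (2 - Real.exp (M + 1)) with ht
  have h0 : 0 < t := Real.exp_pos _
  have h1 : t ≤ 1 := by
    rw [ht, Real.exp_le_one_iff]
    linarith [Real.add_one_le_exp (M + 1)]
  refine ⟨((1 - t : ℝ) : ℂ), ?_, ?_⟩
  · rw [mem_disc_iff, Complex.norm_real, Real.norm_eq_abs, abs_of_nonneg (by linarith)]
    linarith
  · have h2 : shiftedLog ((1 - t : ℝ) : ℂ) = ((Real.exp (M + 1) : ℝ) : ℂ) := by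
      rw [shiftedLog, show (1 : ℂ) - ((1 - t : ℝ) : ℂ) = (t : ℂ) by push_cast; ring,
        ← Complex.ofReal_log h0.le, ht, Real.log_exp]
      push_cast
      ring
    rw [logLog_re, h2, Complex.norm_real, Real.norm_of_nonneg (Real.exp_pos _).le, Real.log_exp]
    linarith

theorem not_memLp_top_of_continuousOn {φ : ℂ → ℝ} (hc : ContinuousOn φ disc)
    (h : ∀ M, ∃ z ∈ disc, M < φ z) : ¬ MemLp φ ∞ (volume.restrict (closure disc)) := by
  intro hφ
  have h1 : MemLp φ ∞ (volume.restrict disc) :=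
    hφ.mono_measure (Measure.restrict_mono subset_closure le_rfl)
  have h2 := h1.eLpNorm_lt_top
  rw [eLpNorm_exponent_top] at h2
  obtain ⟨z, hz, hM⟩ := h (eLpNormEssSup φ (volume.restrict disc)).toReal
  set M := (eLpNormEssSup φ (volume.restrict disc)).toReal with hMdef
  have hU : IsOpen (disc ∩ φ ⁻¹' Ioi M) := hc.isOpen_inter_preimage isOpen_disc isOpen_Ioi
  have h3 := ae_le_eLpNormEssSup (f := φ) (μ := volume.restrict disc)
  rw [ae_restrict_iff' measurableSet_disc] at h3
  have h4 : volume (disc ∩ φ ⁻¹' Ioi M) = 0 := by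
    refine measure_mono_null (fun w hw => ?_) h3
    simp only [mem_compl_iff, mem_ofPred_eq, Classical.not_imp, not_le]
    refine ⟨hw.1, ?_⟩
    rw [← ENNReal.ofReal_toReal h2.ne, ← hMdef, ← ofReal_norm]
    have hw2 : M < φ w := hw.2
    have hM0 : 0 ≤ M := ENNReal.toReal_nonneg
    exact (ENNReal.ofReal_lt_ofReal_iff (norm_pos_iff.2 (by linarith))).2
      (hw2.trans_le (le_abs_self _))
  exact (hU.measure_pos volume ⟨z, hz, hM⟩).ne' h4

end NeumannJacobian

end

open NeumannJacobian

theorem mainTheorem2 :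
    ∃ a b : ℂ → ℝ,
      (MemLp a ∞ (volume.restrict NeumannJacobian.disc) ∧ NeumannJacobian.MemW1 2 a) ∧
      (MemLp b ∞ (volume.restrict NeumannJacobian.disc) ∧ NeumannJacobian.MemW1 2 b) ∧
      ∃ φ : ℂ → ℝ,
        NeumannJacobian.IsZeroMeanNeumannSolution a b φ ∧
        (∀ φ' : ℂ → ℝ, NeumannJacobian.IsZeroMeanNeumannSolution a b φ' →
          φ' =ᵐ[volume.restrict NeumannJacobian.disc] φ) ∧
        ¬ MemLp φ ∞ (volume.restrict (closure NeumannJacobian.disc)) := by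
  -- The bounded function `a = 1 + cos v` makes `a ∇v` the gradient of the unbounded function
  -- `v + sin v`, and `∇v = - ∇^⊥ b` by the Cauchy–Riemann equations.
  set v : ℂ → ℝ := fun z => (logLog z).re with hv
  set b : ℂ → ℝ := fun z => -(logLog z).im with hb
  set a : ℂ → ℝ := fun z => 1 + Real.cos (v z) with ha
  set φ₀ : ℂ → ℝ := fun z => v z + Real.sin (v z) with hφ₀
  set c : ℝ := (∫ z in disc, φ₀ z) / volume.real disc with hc
  set φ : ℂ → ℝ := fun z => v z + Real.sin (v z) - c with hφ
  have cv : ContDiffOn ℝ ∞ v disc := Complex.reCLM.contDiff.comp_contDiffOn contDiffOn_logLog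
  have cb : ContDiffOn ℝ ∞ b disc :=
    (Complex.imCLM.contDiff.comp_contDiffOn contDiffOn_logLog).neg
  have ca : ContDiffOn ℝ ∞ a disc := contDiffOn_const.add (Real.contDiff_cos.comp_contDiffOn cv)
  have cφ₀ : ContDiffOn ℝ ∞ φ₀ disc := cv.add (Real.contDiff_sin.comp_contDiffOn cv)
  have cφ : ContDiffOn ℝ ∞ φ disc := cφ₀.sub contDiffOn_const
  have dv : ∀ z ∈ disc, DifferentiableAt ℝ v z := fun z hz =>
    (cv.contDiffAt (isOpen_disc.mem_nhds hz)).differentiableAt (by simp)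
  have gv : ∀ z ∈ disc, gradient v z = starRingEnd ℂ ((1 - z)⁻¹ / shiftedLog z) := fun z hz =>
    gradient_re_of_hasDerivAt (hasDerivAt_logLog hz)
  have gb : ∀ z ∈ disc, gradient b z = -Complex.I * starRingEnd ℂ ((1 - z)⁻¹ / shiftedLog z) :=
    fun z hz => gradient_neg_im_of_hasDerivAt (hasDerivAt_logLog hz)
  have ga : ∀ z ∈ disc, gradient a z = (-Real.sin (v z)) • gradient v z := fun z hz =>
    gradient_comp_real (dv z hz) ((Real.hasDerivAt_cos _).const_add 1)
  have gφ : ∀ z ∈ disc, gradient φ z = (1 + Real.cos (v z)) • gradient v z := fun z hz =>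
    gradient_comp_real (g := fun x => x + Real.sin x - c) (dv z hz)
      (((hasDerivAt_id _).add (Real.hasDerivAt_sin _)).sub_const c)
  -- Each gradient is bounded by a multiple of the derivative of `logLog`.
  have grad_memLp : ∀ {u : ℂ → ℝ} (C : ℝ), ContDiffOn ℝ ∞ u disc →
      (∀ z ∈ disc, ‖gradient u z‖ ≤ C * ‖(1 - z)⁻¹ / shiftedLog z‖) →
      MemLp (gradient u) 2 (volume.restrict disc) := by
    intro u C hu h
    refine memLp_deriv_logLog.of_le_mul (c := C) (aestronglyMeasurable_gradient hu) ?_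
    filter_upwards [ae_restrict_mem measurableSet_disc] with z hz
    exact h z hz
  have Lga : MemLp (gradient a) 2 (volume.restrict disc) := grad_memLp 1 ca fun z hz => by
    rw [ga z hz, gv z hz, norm_smul, Complex.norm_conj, norm_neg]
    gcongr
    exact Real.abs_sin_le_one _
  have Lgb : MemLp (gradient b) 2 (volume.restrict disc) := grad_memLp 1 cb fun z hz => by
    rw [gb z hz, norm_mul, Complex.norm_conj]
    simp
  have Lgφ : MemLp (gradient φ) 2 (volume.restrict disc) := grad_memLp 2 cφ fun z hz => by
    rw [gφ z hz, gv z hz, norm_smul, Complex.norm_conj]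
    gcongr
    refine (norm_add_le _ _).trans ?_
    rw [norm_one]
    have : ‖Real.cos (v z)‖ ≤ 1 := Real.abs_cos_le_one _
    linarith
  have La : MemLp a ∞ (volume.restrict disc) :=
    memLp_top_of_bound (ca.continuousOn.aestronglyMeasurable measurableSet_disc) 2
      (Filter.Eventually.of_forall fun z => by
        refine (norm_add_le _ _).trans ?_
        rw [norm_one]
        have : ‖Real.cos (v z)‖ ≤ 1 := Real.abs_cos_le_one _
        linarith)
  have Lb : MemLp b ∞ (volume.restrict disc) :=
    memLp_top_of_bound (cb.continuousOn.aestronglyMeasurable measurableSet_disc) Real.pi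
      (Filter.Eventually.of_forall fun z => by
        rw [hb, norm_neg, logLog, Complex.log_im]
        exact Complex.abs_arg_le_pi _)
  have iφ₀ : IntegrableOn φ₀ disc := by
    refine integrableOn_logLog_re.add ?_
    refine Integrable.of_bound ((Real.contDiff_sin.comp_contDiffOn
      cv).continuousOn.aestronglyMeasurable measurableSet_disc) 1
      (Filter.Eventually.of_forall fun z => Real.abs_sin_le_one _)
  have iφ : IntegrableOn φ disc := iφ₀.sub (integrable_const c)
  have mean : ∫ z in disc, φ z = 0 := by
    have h0 : volume.real disc ≠ 0 :=
      (ENNReal.toReal_pos (Metric.measure_ball_pos volume (0 : ℂ) one_pos).ne'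
        measure_ball_lt_top.ne).ne'
    have h1 : ∫ z in disc, φ z = (∫ z in disc, φ₀ z) - ∫ z in disc, c :=
      integral_sub iφ₀ (integrable_const c)
    rw [h1, setIntegral_const, smul_eq_mul, hc, mul_div_cancel₀ _ h0, sub_self]
  have sol : IsZeroMeanNeumannSolution a b φ := by
    refine ⟨isNeumannSolution_of_gradient_eq ca cb cφ Lga Lgb iφ
      (Lgφ.integrable (by norm_num)) fun z hz => ?_, mean⟩
    rw [gφ z hz, gb z hz, gv z hz, perp_eq, ha, ← smul_neg]
    congr 1
    rw [← mul_assoc, neg_mul_neg, Complex.I_mul_I, neg_one_mul, neg_neg]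
  refine ⟨a, b, ⟨La, memW1_of_contDiffOn ca (La.mono_exponent le_top) Lga⟩,
    ⟨Lb, memW1_of_contDiffOn cb (Lb.mono_exponent le_top) Lgb⟩, φ, sol,
    fun φ' h => h.ae_eq sol, not_memLp_top_of_continuousOn cφ.continuousOn fun M => ?_⟩
  obtain ⟨z, hz, h⟩ := exists_lt_logLog_re (M + 1 + c)
  refine ⟨z, hz, ?_⟩
  have := Real.neg_one_le_sin (v z)
  simp only [hφ, hv] at this ⊢
  linarith
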